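/- **Conventions.** $\|\cdot\|_F$ is the Frobenius norm, $\|\cdot\|$ the $\ell_2$ norm of a vector, $A(i,\cdot)$ the $i$-th row of $A$, $\dagger$ the conjugate transpose. For a nonzero $A\in\mathbb{C}^{m\times n}$ let $p_{\mathrm{row}(A)}(i)=\|A(i,\cdot)\|^2/\|A\|_F^2$ for $i\in\{1,\dots,m\}$. For a positive semidefinite Hermitian $H=\sum_i\lambda_i v_iv_i^\dagger$ (with $\{v_i\}_i$ an orthonormal basis of eigenvectors) and $g\colon\mathbb{R}_{\ge 0}\to\mathbb{C}$ let $g(H)=\sum_i g(\lambda_i)v_iv_i^\dagger$, and for $\chi\ge 0$ let $\mathrm{spec}_\chi(H)=\{x\in\mathbb{R}_{\ge0} : |x-\lambda_i|\le\chi\text{ for some } i\}$. *Smoothness.* $f\colon\mathbb{R}_{\ge0}\to\mathbb{C}$ is $(L,\bar L)$-smooth on $\Lambda\subseteq\mathbb{R}_{\ge0}$ if $f(0)=0$, the limit of $f(x)/x$ as $x\to0$ exists, $|f(x)-f(y)|\le L|x-y|$ for all $x,y\in\Lambda$, and $|\bar f(x)-\bar f(y)|\le\bar L|x-y|$ for all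 $x,y\in\Lambda$, where $\bar f(x)=f(x)/x$ for $x>0$ and $\bar f(0)=\lim_{x\to0}f(x)/x$. *Sketches.* Given probability distributions $p,\tilde p$ on $\{1,\dots,m\}$, the $r\times m$ matrix sampled according to $(p,\tilde p)$ is the random real matrix $S$ obtained by drawing $s_1,\dots,s_r$ independently from $\tilde p$ and letting the $i$-th row of $S$ be $e_{s_i}/\sqrt{r\,p(s_i)}$ if $p(s_i)>0$ and $0$ otherwise. An $(r,\varepsilon,\phi)$-approximate importance matrix sketch of a nonzero $A\in\mathbb{C}^{m\times n}$ is a random matrix sampled according to $(p,\tilde p)$ for some probability distributions $p,\tilde p$ with $p(i)\ge\frac1\phi p_{\mathrm{row}(A)}(i)$ for all $i$ and $\frac12\sum_i|\tilde p(i)-p(i)|\le\varepsilon$. **Theorem.** Let $A\in\mathbb{C}^{m\times n}$ be a nonzero matrix and $f\colon\mathbb{R}_{\ge0}\to\mathbb{C}$ an $(L,\bar L)$-smooth function on $\mathrm{spec}_\chi(A^\dagger A)$, for some $L,\bar L,\chi>0$. Let $\delta\in(0,1]$, $\gamma>0$ and $\phi,\phi'\ge1$, and let $\varepsilon\ge0$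 and the integers $r\in\{1,\dots,m\}$, $c\in\{1,\dots,n\}$ satisfy $$\varepsilon\le\min\left(\frac1{8\phi},\ \frac{\chi}{24(\phi+\phi')\|A\|_F^2},\ \frac{\gamma}{24L\phi\|A\|_F^2},\ \frac{\gamma}{48\bar L\phi'\|A\|_F^4}\right),$$ $$r\ge\max\left(2\phi^2\ln(6/\delta),\ 112\,\phi^2\|A\|_F^4\left(\frac{\ln(6/\delta)}{\chi^2}+\frac{\ln(6/\delta)L^2}{\gamma^2}\right)\right),$$ $$c\ge112\,\phi'^2\|A\|_F^4\left(\frac{\ln(6/\delta)}{\chi^2}+\frac{4\ln(6/\delta)\bar L^2\|A\|_F^4}{\gamma^2}\right).$$ Let $S\in\mathbb{R}^{r\times m}$ be an $(r,\varepsilon,\phi)$-approximate importance matrix sketch of $A$ and let $T\in\mathbb{R}^{c\times n}$ be, conditionally on $S$ and whenever $SA\ne0$, a $(c,\varepsilon,\phi')$-approximate importance matrix sketch of $(SA)^\dagger$ (if $SA=0$, $T$ is arbitrary). Then for $R=SA$ and $C=SAT^\dagger$, with probability at least $1-\delta$, $$\left\|R^\dagger\,\bar f(CC^\dagger)\,R-f(A^\dagger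 A)\right\|_F\le\gamma .$$ -/

import Mathlib

open MeasureTheory ProbabilityTheory Filter Topology
open scoped NNReal ENNReal ComplexOrder Matrix Matrix.Norms.Frobenius

/-! Throughout, the norm of a matrix is the Frobenius norm (see `open scoped` above),
and probability distributions on `Fin m` are the points of `stdSimplex ℝ (Fin m)`. -/

/-- For a positive semidefinite Hermitian `H` and `χ ≥ 0`, the set `spec_χ(H)` of the nonnegative
reals at distance at most `χ` from some eigenvalue of `H`. -/
noncomputable def specNhd {n : ℕ} (χ : ℝ) {H : Matrix (Fin n) (Fin n) ℂ}
    (hH : H.PosSemidef) : Set ℝ≥0 :=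
  {x | ∃ z ∈ Set.range hH.isHermitian.eigenvalues, |(x : ℝ) - z| ≤ χ}

/-- The singular value transformation `f(H) = ∑ i, f(λ_i) v_i v_i†` of a positive semidefinite
Hermitian matrix `H` with eigenvalues `λ_i` and an orthonormal basis of eigenvectors `v_i`. -/
noncomputable def singularValueTransformation {n : ℕ} (f : ℝ≥0 → ℂ)
    {H : Matrix (Fin n) (Fin n) ℂ} (hH : H.PosSemidef) : Matrix (Fin n) (Fin n) ℂ :=
  ∑ i, f ⟨hH.isHermitian.eigenvalues i, hH.eigenvalues_nonneg i⟩ •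
    Matrix.vecMulVec (hH.isHermitian.eigenvectorBasis i : Fin n → ℂ)
      (star (hH.isHermitian.eigenvectorBasis i : Fin n → ℂ))

/-- `f̄(x) = f(x)/x` for `x > 0`, and `f̄(0)` is the limit of `f(x)/x` as `x → 0`. -/
noncomputable def fbar (f : ℝ≥0 → ℂ) (x : ℝ≥0) : ℂ :=
  if x = 0 then limUnder (𝓝[≠] (0 : ℝ≥0)) (fun y : ℝ≥0 => f y / ((y : ℝ) : ℂ))
  else f x / ((x : ℝ) : ℂ)

/-- `f` is `(L, L̄)`-smooth on `Λ`. -/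
structure IsSmoothOn (f : ℝ≥0 → ℂ) (L Lbar : ℝ) (Λ : Set ℝ≥0) : Prop where
  map_zero : f 0 = 0
  limit_exists : ∃ c : ℂ,
    Tendsto (fun x : ℝ≥0 => f x / ((x : ℝ) : ℂ)) (𝓝[≠] (0 : ℝ≥0)) (𝓝 c)
  lipschitz : ∀ x ∈ Λ, ∀ y ∈ Λ, ‖f x - f y‖ ≤ L * |(x : ℝ) - (y : ℝ)|
  lipschitz_fbar : ∀ x ∈ Λ, ∀ y ∈ Λ, ‖fbar f x - fbar f y‖ ≤ Lbar * |(x : ℝ) - (y : ℝ)|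

/-- The distribution `p_{row(A)}`: `i ↦ ‖A(i,·)‖² / ‖A‖_F²`, with the `ℓ₂` norm of the row. -/
noncomputable def rowDist {m n : ℕ} (A : Matrix (Fin m) (Fin n) ℂ) (i : Fin m) : ℝ :=
  (∑ j, ‖A i j‖ ^ 2) / ‖A‖ ^ 2

/-- The total variation distance of two distributions on `Fin m`. -/
noncomputable def tvDist {m : ℕ} (p q : Fin m → ℝ) : ℝ :=
  (1 / 2) * ∑ i, |p i - q i|

/-- The `r × m` matrix whose `i`-th row is `e_{s i} / √(r p(s i))` if `p (s i) > 0`,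
and `0` otherwise. -/
noncomputable def sampleMatrix {r m : ℕ} (p : Fin m → ℝ) (s : Fin r → Fin m) :
    Matrix (Fin r) (Fin m) ℝ :=
  fun i j => if 0 < p (s i) ∧ j = s i then 1 / √((r : ℝ) * p (s i)) else 0

/-- The random matrix `S` is sampled according to `(p, pt)`: its rows come from independent
indices, each of them distributed according to `pt`, rescaled with `p`. -/
def IsSampledAccordingTo {Ω : Type*} [MeasurableSpace Ω] (P : Measure Ω) {r m : ℕ}
    (p pt : Fin m → ℝ) (S : Ω → Matrix (Fin r) (Fin m) ℝ) : Prop :=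
  ∃ s : Fin r → Ω → Fin m,
    (∀ i, Measurable (s i)) ∧
    iIndepFun s P ∧
    (∀ i j, P {ω | s i ω = j} = ENNReal.ofReal (pt j)) ∧
    ∀ᵐ ω ∂P, S ω = sampleMatrix p (fun i => s i ω)

/-- Under the probability measure `P`, the random `r × m` matrix `S` is an
`(r, ε, φ)`-approximate importance matrix sketch of the (nonzero) matrix `A`. -/
def IsApproxImportanceSketch {Ω : Type*} [MeasurableSpace Ω] (P : Measure Ω) {r m n : ℕ}
    (ε φ : ℝ) (A : Matrix (Fin m) (Fin n) ℂ) (S : Ω → Matrix (Fin r) (Fin m) ℝ) : Prop :=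
  ∃ p ∈ stdSimplex ℝ (Fin m), ∃ pt ∈ stdSimplex ℝ (Fin m),
    (∀ i, (1 / φ) * rowDist A i ≤ p i) ∧
    tvDist pt p ≤ ε ∧
    IsSampledAccordingTo P p pt S

/-- `R = S A` for a real matrix `S` and a complex matrix `A`. -/
noncomputable def sketchR {r m n : ℕ} (S : Matrix (Fin r) (Fin m) ℝ)
    (A : Matrix (Fin m) (Fin n) ℂ) : Matrix (Fin r) (Fin n) ℂ :=
  S.map Complex.ofReal * A

/-- `C = S A T†` for real matrices `S`, `T` and a complex matrix `A`. -/
noncomputable def sketchC {r m n c : ℕ} (S : Matrix (Fin r) (Fin m) ℝ)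
    (A : Matrix (Fin m) (Fin n) ℂ) (T : Matrix (Fin c) (Fin n) ℝ) :
    Matrix (Fin r) (Fin c) ℂ :=
  S.map Complex.ofReal * A * (T.map Complex.ofReal)ᴴ

/-! The error splits through the exact identity R† f̄(RR†) R = f(R†R): it remains to compare f(R†R)
with f(A†A), and f̄(CC†) with f̄(RR†) between the outer factors R† and R. For positive semidefinite
H, G and W the overlap matrix of their eigenbases, f(H) − f(G) has entries (f(λ_i) − f(μ_j)) W_ij
where H − G has (λ_i − μ_j) W_ij, so a Lipschitz bound on eigenvalues passes to the Frobenius norm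
with the same constant. The error is thus at most L‖R†R − A†A‖ + L̄‖R‖²‖CC† − RR†‖.

The difficulty is that smoothness holds only on spec_χ(A†A), while RR† and CC† may have an
eigenvalue 0 far from it. Eigenvectors whose eigenvalue leaves spec_χ(A†A) lie in ker R†, so the
outer factors annihilate them (`norm_sketched_singularValueTransformation_sub_le`).

For the probabilities, R†R and, conditionally on S, CC† are averages of independent matrices of rank
at most one. The dimension-free Pinelis inequality (`sum_prod_le_two_mul_exp`) controls their
deviations (`measure_gram_sketch_le`, `measure_second_sketch_le`), and Hoeffding controls ‖R‖²
(`measure_norm_sketch_le`). A union bound over these three events finishes. -/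

/-- The function `u ↦ cosh √u` is convex on `[0, ∞)`. -/
theorem convexOn_cosh_sqrt : ConvexOn ℝ (Set.Ici (0 : ℝ)) fun u => Real.cosh (√u) := by
  -- A power series in u with nonnegative coefficients, each of whose terms is convex on [0, ∞).
  have key : ∀ u : ℝ, 0 ≤ u →
      HasSum (fun k : ℕ => u ^ k / ((2 * k).factorial : ℝ)) (Real.cosh (√u)) := by
    intro u hu
    have h := Real.hasSum_cosh (√u)
    simpa only [pow_mul, Real.sq_sqrt hu] using h
  refine ⟨convex_Ici 0, fun x hx y hy a b ha hb hab => ?_⟩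
  have hx' : (0 : ℝ) ≤ x := hx
  have hy' : (0 : ℝ) ≤ y := hy
  have h1 := key (a • x + b • y) (by simp only [smul_eq_mul]; positivity)
  have h2 := ((key x hx').mul_left a).add ((key y hy').mul_left b)
  refine hasSum_le (fun k => ?_) h1 h2
  have hc := (convexOn_pow k).2 hx' hy' ha hb hab
  simp only [smul_eq_mul] at hc ⊢
  calc (a * x + b * y) ^ k / ((2 * k).factorial : ℝ)
      ≤ (a * x ^ k + b * y ^ k) / ((2 * k).factorial : ℝ) := by gcongr
    _ = _ := by ring

/-! ### Dimension-free tail bound in Hilbert space. -/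

section Pinelis

variable {E : Type*} [NormedAddCommGroup E] [InnerProductSpace ℂ E]

/-- Comparison of `cosh ‖s + y‖` with an affine function of `y` on the ball of radius `c`. -/
theorem cosh_norm_add_le (s y : E) {c : ℝ} (hc : 0 < c) (hy : ‖y‖ ≤ c) :
    Real.cosh ‖s + y‖ ≤ Real.cosh ‖s‖ * Real.cosh c +
      (inner ℂ s y).re * (Real.sinh ‖s‖ * Real.sinh c / (‖s‖ * c)) := by
  rcases eq_or_ne s 0 with rfl | hs
  · have : Real.cosh ‖y‖ ≤ Real.cosh c := Real.cosh_le_cosh.2 (by simpa [abs_of_pos hc] using hy)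
    simpa using this
  have ha : 0 < ‖s‖ := norm_pos_iff.2 hs
  set a := ‖s‖ with ha_def
  set β := (inner ℂ s y).re with hβ
  have hβle : |β| ≤ a * c :=
    (Complex.abs_re_le_norm _).trans ((norm_inner_le_norm s y).trans (by gcongr))
  have hb := abs_le.1 hβle
  have hac : 0 < a * c := mul_pos ha hc
  have hsq : ‖s + y‖ ^ 2 = a ^ 2 + 2 * β + ‖y‖ ^ 2 := by
    simpa using norm_add_sq (𝕜 := ℂ) s y
  -- ‖s + y‖² ≤ a² + 2β + c², and the right side lies between (a − c)² and (a + c)², with weight θ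
  -- on the latter. The chord of cosh √ over this interval is affine in β, hence in y.
  set θ := (1 + β / (a * c)) / 2 with hθ
  have hq : |β / (a * c)| ≤ 1 := by
    rw [abs_div, abs_of_pos hac]; exact (div_le_one hac).2 hβle
  have hq' := abs_le.1 hq
  have hconv := convexOn_cosh_sqrt.2 (Set.mem_Ici.2 (sq_nonneg (a + c)))
    (Set.mem_Ici.2 (sq_nonneg (a - c))) (show 0 ≤ θ by linarith) (show 0 ≤ 1 - θ by linarith)
    (by ring)
  simp only [smul_eq_mul, Real.sqrt_sq_eq_abs, Real.cosh_abs] at hconv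
  have harg : θ * (a + c) ^ 2 + (1 - θ) * (a - c) ^ 2 = a ^ 2 + 2 * β + c ^ 2 := by
    rw [hθ]; field_simp; ring
  rw [harg, Real.cosh_add, Real.cosh_sub] at hconv
  have h1 : Real.cosh ‖s + y‖ ≤ Real.cosh √(a ^ 2 + 2 * β + c ^ 2) := by
    rw [Real.cosh_le_cosh, abs_of_nonneg (norm_nonneg _), abs_of_nonneg (Real.sqrt_nonneg _)]
    apply Real.le_sqrt_of_sq_le
    rw [hsq]
    gcongr
  refine h1.trans (hconv.trans (le_of_eq ?_))
  rw [hθ]; field_simp; ring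

variable {ι : Type*} [Fintype ι]

/-- One step of the martingale argument for sums of centred bounded vectors. -/
theorem sum_mul_cosh_norm_add_le {q : ι → ℝ} (hq : ∀ i, 0 ≤ q i) (hq1 : ∑ i, q i = 1)
    {Y : ι → E} (h0 : ∑ i, (q i : ℂ) • Y i = 0) {c : ℝ} (hc : 0 < c) (hY : ∀ i, ‖Y i‖ ≤ c)
    (s : E) :
    ∑ i, q i * Real.cosh ‖s + Y i‖ ≤ Real.exp (c ^ 2 / 2) * Real.cosh ‖s‖ := by
  have hin : ∑ i, q i * (inner ℂ s (Y i)).re = 0 := by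
    have := congrArg (fun v => (inner ℂ s v).re) h0
    simpa [inner_sum, inner_smul_right] using this
  calc ∑ i, q i * Real.cosh ‖s + Y i‖
      ≤ ∑ i, q i * (Real.cosh ‖s‖ * Real.cosh c +
        (inner ℂ s (Y i)).re * (Real.sinh ‖s‖ * Real.sinh c / (‖s‖ * c))) :=
        Finset.sum_le_sum fun i _ =>
          mul_le_mul_of_nonneg_left (cosh_norm_add_le s (Y i) hc (hY i)) (hq i)
    _ = (∑ i, q i) * (Real.cosh ‖s‖ * Real.cosh c) +
        (∑ i, q i * (inner ℂ s (Y i)).re) *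
          (Real.sinh ‖s‖ * Real.sinh c / (‖s‖ * c)) := by
        rw [Finset.sum_mul, Finset.sum_mul, ← Finset.sum_add_distrib]
        exact Finset.sum_congr rfl fun i _ => by ring
    _ = Real.cosh c * Real.cosh ‖s‖ := by rw [hq1, hin]; ring
    _ ≤ _ := by
        gcongr
        exact Real.cosh_le_exp_half_sq c

/-- Induction peels off the first sample; the starting point `s` is arbitrary so that it can absorb
that sample. -/
theorem sum_prod_mul_cosh_norm_le {q : ι → ℝ} (hq : ∀ i, 0 ≤ q i) (hq1 : ∑ i, q i = 1)
    {Y : ι → E} (h0 : ∑ i, (q i : ℂ) • Y i = 0) {c : ℝ} (hc : 0 < c) (hY : ∀ i, ‖Y i‖ ≤ c)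
    (k : ℕ) (s : E) :
    ∑ t : Fin k → ι, (∏ j, q (t j)) * Real.cosh ‖s + ∑ j, Y (t j)‖ ≤
      Real.exp (k * (c ^ 2 / 2)) * Real.cosh ‖s‖ := by
  induction k generalizing s with
  | zero => simp
  | succ k ih =>
    rw [← (Fin.consEquiv fun _ : Fin (k + 1) => ι).sum_comp, Fintype.sum_prod_type]
    simp only [Fin.consEquiv_apply, Fin.prod_univ_succ, Fin.sum_univ_succ, Fin.cons_zero,
      Fin.cons_succ]
    calc ∑ i, ∑ t : Fin k → ι, q i * (∏ j, q (t j)) *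
            Real.cosh ‖s + (Y i + ∑ j, Y (t j))‖
        = ∑ i, q i * ∑ t : Fin k → ι, (∏ j, q (t j)) *
            Real.cosh ‖(s + Y i) + ∑ j, Y (t j)‖ := by
          simp only [Finset.mul_sum, mul_assoc, add_assoc]
      _ ≤ ∑ i, q i * (Real.exp (k * (c ^ 2 / 2)) * Real.cosh ‖s + Y i‖) :=
          Finset.sum_le_sum fun i _ => mul_le_mul_of_nonneg_left (ih _) (hq i)
      _ = Real.exp (k * (c ^ 2 / 2)) * ∑ i, q i * Real.cosh ‖s + Y i‖ := by
          rw [Finset.mul_sum]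
          exact Finset.sum_congr rfl fun i _ => by ring
      _ ≤ Real.exp (k * (c ^ 2 / 2)) * (Real.exp (c ^ 2 / 2) * Real.cosh ‖s‖) := by
          gcongr
          exact sum_mul_cosh_norm_add_le hq hq1 h0 hc hY s
      _ = _ := by
          rw [← mul_assoc, ← Real.exp_add]
          congr 2
          push_cast
          ring

open Classical in
/-- The **Pinelis inequality** for sums of independent, identically distributed, centred and
bounded vectors, as a statement about finite sums. -/
theorem sum_prod_le_two_mul_exp {q : ι → ℝ} (hq : ∀ i, 0 ≤ q i) (hq1 : ∑ i, q i = 1)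
    {Y : ι → E} (h0 : ∑ i, (q i : ℂ) • Y i = 0) {c : ℝ} (hc : 0 < c) (hY : ∀ i, ‖Y i‖ ≤ c)
    {k : ℕ} (hk : 0 < k) {τ : ℝ} (hτ : 0 ≤ τ) :
    ∑ t : Fin k → ι, (if τ ≤ ‖∑ j, Y (t j)‖ then ∏ j, q (t j) else 0) ≤
      2 * Real.exp (-(τ ^ 2 / (2 * k * c ^ 2))) := by
  have hk' : (0 : ℝ) < k := by exact_mod_cast hk
  rcases hτ.eq_or_lt with rfl | hτ
  · have : ∑ t : Fin k → ι, ∏ j, q (t j) = 1 := by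
      rw [← Fintype.piFinset_univ, ← Finset.prod_univ_sum]
      simp [hq1]
    simp [this]
  -- Minimises the exponent k l² c² / 2 − l τ given by Markov's inequality and cosh x ≥ exp x / 2.
  set l : ℝ := τ / (k * c ^ 2) with hl
  have hlpos : 0 < l := by positivity
  have hsm : ∀ v : E, ‖(l : ℂ) • v‖ = l * ‖v‖ := fun v => by
    rw [norm_smul, Complex.norm_real, Real.norm_of_nonneg hlpos.le]
  have main := sum_prod_mul_cosh_norm_le hq hq1 (Y := fun i => (l : ℂ) • Y i)
    (by
      have : ∑ i, (q i : ℂ) • (l : ℂ) • Y i = (l : ℂ) • ∑ i, (q i : ℂ) • Y i := by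
        rw [Finset.smul_sum]
        exact Finset.sum_congr rfl fun i _ => smul_comm _ _ _
      rw [this, h0, smul_zero])
    (c := l * c) (by positivity)
    (fun i => by rw [hsm]; exact mul_le_mul_of_nonneg_left (hY i) hlpos.le) k 0
  simp only [zero_add, norm_zero, Real.cosh_zero, mul_one, ← Finset.smul_sum, hsm] at main
  have hP : ∀ t : Fin k → ι, 0 ≤ ∏ j, q (t j) := fun t => Finset.prod_nonneg fun j _ => hq _
  have step : (∑ t : Fin k → ι, (if τ ≤ ‖∑ j, Y (t j)‖ then ∏ j, q (t j) else 0)) *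
      (Real.exp (l * τ) / 2) ≤ Real.exp (k * ((l * c) ^ 2 / 2)) := by
    refine le_trans ?_ main
    rw [Finset.sum_mul]
    refine Finset.sum_le_sum fun t _ => ?_
    split_ifs with h
    · refine mul_le_mul_of_nonneg_left ?_ (hP t)
      have h2 : Real.exp (l * τ) ≤ Real.exp (l * ‖∑ j, Y (t j)‖) := by gcongr
      rw [Real.cosh_eq]
      have := Real.exp_pos (-(l * ‖∑ j, Y (t j)‖))
      linarith
    · simpa using mul_nonneg (hP t) (Real.cosh_pos _).le
  rw [← le_div_iff₀ (by positivity)] at step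
  refine step.trans (le_of_eq ?_)
  rw [div_div_eq_mul_div, mul_comm, mul_div_assoc, ← Real.exp_sub]
  congr 2
  rw [hl]; field_simp; ring

end Pinelis

/-! ### The Frobenius norm: unitary invariance and entrywise comparison. -/

section Frobenius

variable {l m n : Type*} [Fintype l] [Fintype m] [Fintype n]

theorem frobenius_norm_sq (M : Matrix m n ℂ) : ‖M‖ ^ 2 = ∑ i, ∑ j, ‖M i j‖ ^ 2 := by
  rw [Matrix.frobenius_norm_def, ← Real.sqrt_eq_rpow, Real.sq_sqrt (by positivity)]
  simp

theorem frobenius_norm_sq_eq_trace (M : Matrix m n ℂ) : ((‖M‖ ^ 2 : ℝ) : ℂ) = (Mᴴ * M).trace := by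
  rw [frobenius_norm_sq, Finset.sum_comm]
  simp [Matrix.trace, Matrix.mul_apply, Complex.conj_mul']

theorem frobenius_norm_mul_of_conjTranspose_mul_self [DecidableEq m] {U : Matrix l m ℂ}
    (hU : Uᴴ * U = 1) (M : Matrix m n ℂ) : ‖U * M‖ = ‖M‖ := by
  have h : ‖U * M‖ ^ 2 = ‖M‖ ^ 2 := by
    have : ((‖U * M‖ ^ 2 : ℝ) : ℂ) = ((‖M‖ ^ 2 : ℝ) : ℂ) := by
      rw [frobenius_norm_sq_eq_trace, frobenius_norm_sq_eq_trace, Matrix.conjTranspose_mul,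
        Matrix.mul_assoc, ← Matrix.mul_assoc Uᴴ, hU, Matrix.one_mul]
    exact_mod_cast this
  exact (sq_eq_sq₀ (norm_nonneg _) (norm_nonneg _)).1 h

theorem frobenius_norm_mul_conjTranspose_of_conjTranspose_mul_self [DecidableEq m]
    {U : Matrix l m ℂ} (hU : Uᴴ * U = 1) (M : Matrix n m ℂ) : ‖M * Uᴴ‖ = ‖M‖ := by
  rw [← Matrix.frobenius_norm_conjTranspose, Matrix.conjTranspose_mul,
    Matrix.conjTranspose_conjTranspose, frobenius_norm_mul_of_conjTranspose_mul_self hU,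
    Matrix.frobenius_norm_conjTranspose]

theorem frobenius_norm_le_mul_of_entry_le {M N : Matrix m n ℂ} {L : ℝ} (hL : 0 ≤ L)
    (h : ∀ i j, ‖M i j‖ ≤ L * ‖N i j‖) : ‖M‖ ≤ L * ‖N‖ := by
  refine (sq_le_sq₀ (norm_nonneg _) (by positivity)).1 ?_
  rw [mul_pow, frobenius_norm_sq, frobenius_norm_sq, Finset.mul_sum]
  refine Finset.sum_le_sum fun i _ => ?_
  rw [Finset.mul_sum]
  refine Finset.sum_le_sum fun j _ => ?_
  rw [← mul_pow]
  exact pow_le_pow_left₀ (norm_nonneg _) (h i j) 2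

theorem sum_norm_mulVec_sq_le (M : Matrix m n ℂ) (w : n → ℂ) :
    ∑ i, ‖(M *ᵥ w) i‖ ^ 2 ≤ ‖M‖ ^ 2 * ∑ j, ‖w j‖ ^ 2 := by
  have h := Matrix.frobenius_norm_mul M (Matrix.replicateCol Unit w)
  rw [← Matrix.replicateCol_mulVec] at h
  have h2 := pow_le_pow_left₀ (norm_nonneg _) h 2
  rw [mul_pow, frobenius_norm_sq (Matrix.replicateCol _ _),
    frobenius_norm_sq (Matrix.replicateCol _ _)] at h2
  simpa using h2

end Frobenius

/-! ### Functional calculus and eigenvalue perturbation. -/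

namespace Matrix.PosSemidef

variable {n : ℕ} {H : Matrix (Fin n) (Fin n) ℂ} (hH : H.PosSemidef)

/-- The eigenvalues of a positive semidefinite matrix as nonnegative reals. -/
noncomputable def eig (i : Fin n) : ℝ≥0 :=
  ⟨hH.isHermitian.eigenvalues i, hH.eigenvalues_nonneg i⟩

/-- The unitary matrix of eigenvectors. -/
noncomputable def eigU : Matrix (Fin n) (Fin n) ℂ := hH.isHermitian.eigenvectorUnitary

theorem conjTranspose_eigU_mul_eigU : hH.eigUᴴ * hH.eigU = 1 :=
  Unitary.coe_star_mul_self _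

theorem eigU_mul_conjTranspose_eigU : hH.eigU * hH.eigUᴴ = 1 :=
  Unitary.coe_mul_star_self _

theorem singularValueTransformation_eq (f : ℝ≥0 → ℂ) :
    singularValueTransformation f hH =
      hH.eigU * Matrix.diagonal (fun i => f (hH.eig i)) * hH.eigUᴴ := by
  ext a b
  rw [Matrix.mul_apply]
  simp only [singularValueTransformation, Matrix.sum_apply, Matrix.smul_apply,
    Matrix.vecMulVec_apply, Matrix.mul_diagonal, Matrix.conjTranspose_apply,
    Pi.star_apply, smul_eq_mul]
  refine Finset.sum_congr rfl fun i _ => ?_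
  simp only [eigU, Matrix.IsHermitian.eigenvectorUnitary_apply, eig]
  ring

theorem spectral_eig :
    H = hH.eigU * Matrix.diagonal (fun i => ((hH.eig i : ℝ) : ℂ)) * hH.eigUᴴ := by
  have := hH.isHermitian.spectral_theorem
  rw [Unitary.conjStarAlgAut_apply] at this
  exact this

theorem mul_eigU : H * hH.eigU = hH.eigU * Matrix.diagonal (fun i => ((hH.eig i : ℝ) : ℂ)) := by
  rw [congrArg (· * hH.eigU) hH.spectral_eig, Matrix.mul_assoc _ _ hH.eigU, hH.conjTranspose_eigU_mul_eigU, Matrix.mul_one]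

theorem conjTranspose_eigU_mul :
    hH.eigUᴴ * H = Matrix.diagonal (fun i => ((hH.eig i : ℝ) : ℂ)) * hH.eigUᴴ := by
  rw [congrArg (hH.eigUᴴ * ·) hH.spectral_eig, ← Matrix.mul_assoc, ← Matrix.mul_assoc, hH.conjTranspose_eigU_mul_eigU, Matrix.one_mul]

/-- A weak form of the Weyl inequality: every real eigenvalue of `Z` is close to an
eigenvalue of `H`, for an eigenvector of `H` that overlaps with the eigenvector of `Z`. -/
theorem exists_eig_near (Z : Matrix (Fin n) (Fin n) ℂ) {q : Fin n → ℂ} (hq : q ≠ 0) {x : ℝ}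
    (hx : Z *ᵥ q = (x : ℂ) • q) :
    ∃ j, (hH.eigUᴴ *ᵥ q) j ≠ 0 ∧ |x - hH.eig j| ≤ ‖Z - H‖ := by
  set w := hH.eigUᴴ *ᵥ q with hw
  have hqw : hH.eigU *ᵥ w = q := by
    rw [hw, Matrix.mulVec_mulVec, hH.eigU_mul_conjTranspose_eigU, Matrix.one_mulVec]
  have hw0 : w ≠ 0 := fun h => hq (by rw [← hqw, h, Matrix.mulVec_zero])
  -- In the eigenbasis of `H`, the perturbation multiplies coordinate j of `w` by x − λ_j. If all
  -- these factors on the support of `w` exceeded ‖Z − H‖, then `K` would stretch `w` by more than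
  -- its own Frobenius norm.
  set K := hH.eigUᴴ * (Z - H) * hH.eigU with hK
  have hKnorm : ‖K‖ = ‖Z - H‖ := by
    have h1 : (hH.eigUᴴ)ᴴ * hH.eigUᴴ = 1 := by
      rw [Matrix.conjTranspose_conjTranspose, hH.eigU_mul_conjTranspose_eigU]
    have := frobenius_norm_mul_conjTranspose_of_conjTranspose_mul_self h1 (hH.eigUᴴ * (Z - H))
    rw [Matrix.conjTranspose_conjTranspose] at this
    rw [hK, this, frobenius_norm_mul_of_conjTranspose_mul_self h1]
  have hKw : ∀ j, (K *ᵥ w) j = ((x - hH.eig j : ℝ) : ℂ) * w j := by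
    intro j
    have : K *ᵥ w = (x : ℂ) • w - Matrix.diagonal (fun i => ((hH.eig i : ℝ) : ℂ)) *ᵥ w := by
      rw [hK, ← Matrix.mulVec_mulVec, hqw, ← Matrix.mulVec_mulVec, Matrix.sub_mulVec, hx,
        Matrix.mulVec_sub, Matrix.mulVec_smul, Matrix.mulVec_mulVec, hH.conjTranspose_eigU_mul,
        ← Matrix.mulVec_mulVec]
    rw [this]
    simp [Matrix.mulVec_diagonal, sub_mul]
  by_contra! hcon
  have h1 := sum_norm_mulVec_sq_le K w
  rw [hKnorm] at h1
  refine absurd h1 (not_le.2 ?_)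
  rw [Finset.mul_sum]
  obtain ⟨j₀, hj₀⟩ := Function.ne_iff.1 hw0
  have key : ∀ j, w j ≠ 0 → ‖Z - H‖ ^ 2 * ‖w j‖ ^ 2 < ‖(K *ᵥ w) j‖ ^ 2 := by
    intro j hj
    rw [hKw, norm_mul, mul_pow, Complex.norm_real, Real.norm_eq_abs]
    have := hcon j hj
    have := norm_pos_iff.2 hj
    gcongr
  refine Finset.sum_lt_sum (fun j _ => ?_) ⟨j₀, Finset.mem_univ _, key j₀ hj₀⟩
  by_cases hj : w j = 0
  · simp [hj]
  · exact (key j hj).le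

/-- A singular value transformation acts on eigenvectors through their eigenvalues. -/
theorem singularValueTransformation_mul_of_mul_eq (g : ℝ≥0 → ℂ) {k : ℕ}
    {M : Matrix (Fin n) (Fin k) ℂ} {z : Fin k → ℝ≥0}
    (hM : H * M = M * Matrix.diagonal (fun i => ((z i : ℝ) : ℂ))) :
    singularValueTransformation g hH * M = M * Matrix.diagonal (fun i => g (z i)) := by
  have h1 : Matrix.diagonal (fun i => ((hH.eig i : ℝ) : ℂ)) * (hH.eigUᴴ * M) =
      (hH.eigUᴴ * M) * Matrix.diagonal (fun i => ((z i : ℝ) : ℂ)) := by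
    rw [← Matrix.mul_assoc, ← hH.conjTranspose_eigU_mul, Matrix.mul_assoc, hM, Matrix.mul_assoc]
  -- By `h1`, a nonzero entry (i, j) of U†M forces λ_i = z_j, so `g` takes the same value there on
  -- both sides.
  have h2 : Matrix.diagonal (fun i => g (hH.eig i)) * (hH.eigUᴴ * M) =
      (hH.eigUᴴ * M) * Matrix.diagonal (fun i => g (z i)) := by
    ext i j
    have h := congrFun (congrFun h1 i) j
    rw [Matrix.diagonal_mul, Matrix.mul_diagonal] at h ⊢
    by_cases h0 : (hH.eigUᴴ * M) i j = 0
    · simp [h0]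
    · rw [mul_comm] at h
      have h3 := mul_left_cancel₀ h0 h
      have h4 : hH.eig i = z j := by exact_mod_cast h3
      rw [h4, mul_comm]
  rw [hH.singularValueTransformation_eq, Matrix.mul_assoc, Matrix.mul_assoc, h2,
    ← Matrix.mul_assoc, ← Matrix.mul_assoc, hH.eigU_mul_conjTranspose_eigU, Matrix.one_mul]

variable {G : Matrix (Fin n) (Fin n) ℂ} (hG : G.PosSemidef)

theorem conjTranspose_eigU_mul_sub_mul_eigU_apply (i j : Fin n) :
    (hH.eigUᴴ * (H - G) * hG.eigU) i j =
      ((hH.eig i - hG.eig j : ℝ) : ℂ) * (hH.eigUᴴ * hG.eigU) i j := by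
  rw [Matrix.mul_sub, Matrix.sub_mul, hH.conjTranspose_eigU_mul, Matrix.mul_assoc _ G,
    hG.mul_eigU, Matrix.mul_assoc, ← Matrix.mul_assoc hH.eigUᴴ hG.eigU, Matrix.sub_apply,
    Matrix.diagonal_mul, Matrix.mul_diagonal]
  push_cast
  ring

/-- Stated for an arbitrary `N`, not just a difference of transforms, because it is later applied to
an array with some entries erased. -/
theorem norm_le_mul_norm_sub {N : Matrix (Fin n) (Fin n) ℂ} {L : ℝ} (hL : 0 ≤ L)
    (hN : ∀ i j, ‖N i j‖ ≤ L * |(hH.eig i : ℝ) - hG.eig j| * ‖(hH.eigUᴴ * hG.eigU) i j‖) :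
    ‖N‖ ≤ L * ‖H - G‖ := by
  have h1 : (hH.eigUᴴ)ᴴ * hH.eigUᴴ = 1 := by
    rw [Matrix.conjTranspose_conjTranspose, hH.eigU_mul_conjTranspose_eigU]
  have h2 : (hG.eigUᴴ)ᴴ * hG.eigUᴴ = 1 := by
    rw [Matrix.conjTranspose_conjTranspose, hG.eigU_mul_conjTranspose_eigU]
  have h3 : ‖hH.eigUᴴ * (H - G) * hG.eigU‖ = ‖H - G‖ := by
    have := frobenius_norm_mul_conjTranspose_of_conjTranspose_mul_self h2 (hH.eigUᴴ * (H - G))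
    rw [Matrix.conjTranspose_conjTranspose] at this
    rw [this, frobenius_norm_mul_of_conjTranspose_mul_self h1]
  rw [← h3]
  refine frobenius_norm_le_mul_of_entry_le hL fun i j => (hN i j).trans (le_of_eq ?_)
  rw [conjTranspose_eigU_mul_sub_mul_eigU_apply, norm_mul, Complex.norm_real, Real.norm_eq_abs,
    mul_assoc]

theorem singularValueTransformation_sub_eq (f g : ℝ≥0 → ℂ) :
    singularValueTransformation f hH - singularValueTransformation g hG =
      hH.eigU * (Matrix.of fun i j =>
        (f (hH.eig i) - g (hG.eig j)) * (hH.eigUᴴ * hG.eigU) i j) * hG.eigUᴴ := by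
  have h : (Matrix.of fun i j =>
        (f (hH.eig i) - g (hG.eig j)) * (hH.eigUᴴ * hG.eigU) i j) =
      Matrix.diagonal (fun i => f (hH.eig i)) * (hH.eigUᴴ * hG.eigU) -
        (hH.eigUᴴ * hG.eigU) * Matrix.diagonal (fun i => g (hG.eig i)) := by
    ext i j
    rw [Matrix.sub_apply, Matrix.diagonal_mul, Matrix.mul_diagonal, Matrix.of_apply]
    ring
  rw [h, Matrix.mul_sub, Matrix.sub_mul, hH.singularValueTransformation_eq,
    hG.singularValueTransformation_eq]
  congr 1
  · simp only [Matrix.mul_assoc, hG.eigU_mul_conjTranspose_eigU, Matrix.mul_one]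
  · simp only [← Matrix.mul_assoc, hH.eigU_mul_conjTranspose_eigU, Matrix.one_mul]

/-- Perturbation of a singular value transformation whose function is Lipschitz on a set that
contains the eigenvalues of both matrices. -/
theorem norm_singularValueTransformation_sub_le {f : ℝ≥0 → ℂ} {L : ℝ} (hL : 0 ≤ L)
    (hf : ∀ i j, ‖f (hH.eig i) - f (hG.eig j)‖ ≤ L * |(hH.eig i : ℝ) - hG.eig j|) :
    ‖singularValueTransformation f hH - singularValueTransformation f hG‖ ≤ L * ‖H - G‖ := by
  rw [singularValueTransformation_sub_eq,
    frobenius_norm_mul_conjTranspose_of_conjTranspose_mul_self hG.conjTranspose_eigU_mul_eigU,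
    frobenius_norm_mul_of_conjTranspose_mul_self hH.conjTranspose_eigU_mul_eigU]
  refine norm_le_mul_norm_sub hH hG hL fun i j => ?_
  rw [Matrix.of_apply, norm_mul]
  gcongr
  exact hf i j

/-- A vector splits into a part in the kernel of `H` and a part in its range. -/
theorem exists_mulVec_add_of_mulVec_eq_zero {n : ℕ} {H : Matrix (Fin n) (Fin n) ℂ}
    (hH : H.PosSemidef) (u : Fin n → ℂ) :
    ∃ a b, H *ᵥ b = 0 ∧ u = H *ᵥ a + b := by
  set z : Fin n → ℂ := fun i => ((hH.eig i : ℝ) : ℂ) with hz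
  set v := hH.eigUᴴ *ᵥ u with hv
  have hu : u = hH.eigU *ᵥ v := by
    rw [hv, Matrix.mulVec_mulVec, hH.eigU_mul_conjTranspose_eigU, Matrix.one_mulVec]
  have hHU : ∀ x, H *ᵥ (hH.eigU *ᵥ x) = hH.eigU *ᵥ (fun i => z i * x i) := by
    intro x
    rw [Matrix.mulVec_mulVec, hH.mul_eigU, ← Matrix.mulVec_mulVec]
    congr 1
    ext i
    rw [Matrix.mulVec_diagonal]
  -- The pseudo-inverse applied to `u`: with `0⁻¹ = 0` the kernel coordinates drop out of `a` and
  -- are collected in `b`.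
  refine ⟨hH.eigU *ᵥ (fun i => (z i)⁻¹ * v i), hH.eigU *ᵥ (fun i => if z i = 0 then v i else 0),
    ?_, ?_⟩
  · rw [hHU]
    have : (fun i => z i * (if z i = 0 then v i else 0)) = 0 := by
      ext i
      by_cases h : z i = 0 <;> simp [h]
    rw [this, Matrix.mulVec_zero]
  · rw [hHU, ← Matrix.mulVec_add, hu]
    congr 1
    ext i
    by_cases h : z i = 0 <;> simp [h]

end Matrix.PosSemidef

/-! ### Deterministic error bound for the sandwiched transform. -/

section Sandwich

variable {r n : ℕ} (R : Matrix (Fin r) (Fin n) ℂ)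

/-- Moving a singular value transformation of `R R†` to one of `R† R`. -/
theorem conjTranspose_mul_singularValueTransformation_mul (f g : ℝ≥0 → ℂ)
    (h : ∀ x : ℝ≥0, f x = ((x : ℝ) : ℂ) * g x) (hY : (R * Rᴴ).PosSemidef)
    (hZ : (Rᴴ * R).PosSemidef) :
    Rᴴ * singularValueTransformation g hY * R = singularValueTransformation f hZ := by
  -- R carries eigenvectors of R†R to eigenvectors of RR† with the same eigenvalue, or to zero.
  have h1 : R * Rᴴ * (R * hZ.eigU) =
      (R * hZ.eigU) * Matrix.diagonal (fun i => ((hZ.eig i : ℝ) : ℂ)) := by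
    rw [Matrix.mul_assoc R hZ.eigU, ← hZ.mul_eigU]
    simp only [Matrix.mul_assoc]
  have h2 := hY.singularValueTransformation_mul_of_mul_eq g h1
  have h3 : Rᴴ * singularValueTransformation g hY * R * hZ.eigU =
      hZ.eigU * Matrix.diagonal (fun i => f (hZ.eig i)) := by
    rw [Matrix.mul_assoc, Matrix.mul_assoc, h2, ← Matrix.mul_assoc, ← Matrix.mul_assoc,
      hZ.mul_eigU, Matrix.mul_assoc, Matrix.diagonal_mul_diagonal]
    simp only [h]
  rw [hZ.singularValueTransformation_eq, ← h3, Matrix.mul_assoc _ hZ.eigU,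
    hZ.eigU_mul_conjTranspose_eigU, Matrix.mul_one]

/-- Eigenvalues of `R R†` with an eigenvector outside the kernel of `R†` are close to the
spectrum of any approximation of `R† R`. -/
theorem exists_eig_near_of_mul_conjTranspose {B : Matrix (Fin n) (Fin n) ℂ} (hB : B.PosSemidef)
    {v : Fin r → ℂ} {y : ℝ} (hv : (R * Rᴴ) *ᵥ v = (y : ℂ) • v) (hRv : Rᴴ *ᵥ v ≠ 0) :
    ∃ k, |y - hB.eig k| ≤ ‖Rᴴ * R - B‖ := by
  -- R†v is an eigenvector of R†R with the same eigenvalue y.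
  obtain ⟨k, -, hk⟩ := hB.exists_eig_near (Rᴴ * R) hRv (x := y) (by
    rw [Matrix.mulVec_mulVec, Matrix.mul_assoc, ← Matrix.mulVec_mulVec, hv, Matrix.mulVec_smul])
  exact ⟨k, hk⟩

/-- If `X = R G R†`, the eigenvalues of `X` with an eigenvector outside the kernel of `R†` are
close to eigenvalues of `R R†` of the same kind. -/
theorem exists_eig_near_of_sandwich {X : Matrix (Fin r) (Fin r) ℂ} {G : Matrix (Fin n) (Fin n) ℂ}
    (hXG : X = R * G * Rᴴ) (hY : (R * Rᴴ).PosSemidef) {u : Fin r → ℂ} {x : ℝ}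
    (hu : X *ᵥ u = (x : ℂ) • u) (hRu : Rᴴ *ᵥ u ≠ 0) :
    ∃ j, Rᴴ *ᵥ (hY.eigU.col j) ≠ 0 ∧ |x - hY.eig j| ≤ ‖X - R * Rᴴ‖ := by
  -- The component `w` of `u` in the range of RR† is again an eigenvector of `X` for x. Being in the
  -- range of R, it overlaps only with eigenvectors of RR† outside ker R†.
  obtain ⟨a, b, hb, hab⟩ := hY.exists_mulVec_add_of_mulVec_eq_zero u
  have hRb : Rᴴ *ᵥ b = 0 := (Matrix.self_mul_conjTranspose_mulVec_eq_zero R b).1 hb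
  set w := (R * Rᴴ) *ᵥ a with hw
  have hXb : X *ᵥ b = 0 := by
    rw [hXG, ← Matrix.mulVec_mulVec, hRb, Matrix.mulVec_zero]
  have hXw : X *ᵥ w = X *ᵥ u := by rw [hab, Matrix.mulVec_add, hXb, add_zero]
  have hw0 : w ≠ 0 := by
    intro h
    exact hRu (by rw [hab, h, zero_add, hRb])
  -- x b = X u − x w lies both in the range of R and in its orthogonal complement ker R†.
  have hxb : (x : ℂ) • b = 0 := by
    have h1 : (x : ℂ) • b = R *ᵥ (G *ᵥ (Rᴴ *ᵥ u) - (x : ℂ) • (Rᴴ *ᵥ a)) := by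
      have h2 : (x : ℂ) • b = (x : ℂ) • u - (x : ℂ) • w := by rw [hab]; simp
      rw [h2, ← hu, Matrix.mulVec_sub, Matrix.mulVec_smul, hXG, hw]
      simp only [Matrix.mulVec_mulVec, Matrix.mul_assoc]
    have h3 : Rᴴ *ᵥ ((x : ℂ) • b) = 0 := by rw [Matrix.mulVec_smul, hRb, smul_zero]
    rw [h1, Matrix.mulVec_mulVec, Matrix.conjTranspose_mul_self_mulVec_eq_zero] at h3
    rw [h1, h3]
  obtain ⟨j, hj, hj'⟩ := hY.exists_eig_near X hw0 (x := x) (by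
    rw [hXw, hu, hab, smul_add, hxb, add_zero])
  refine ⟨j, fun h => hj ?_, hj'⟩
  have h1 : (hY.eigUᴴ * R) j = 0 := by
    ext k
    have := congrArg star (congrFun h k)
    simpa [Matrix.mulVec, dotProduct, Matrix.mul_apply, mul_comm] using this
  rw [hw, ← Matrix.mulVec_mulVec, Matrix.mulVec_mulVec]
  simp [Matrix.mulVec, h1]

theorem mul_fbar {f : ℝ≥0 → ℂ} (h0 : f 0 = 0) (x : ℝ≥0) : f x = ((x : ℝ) : ℂ) * fbar f x := by
  by_cases hx : x = 0
  · simp [hx, h0]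
  · have : ((x : ℝ) : ℂ) ≠ 0 := by exact_mod_cast hx
    rw [fbar, if_neg hx]
    field_simp

theorem mem_specNhd {χ : ℝ} {B : Matrix (Fin n) (Fin n) ℂ} (hB : B.PosSemidef) {x : ℝ≥0}
    {k : Fin n} (h : |(x : ℝ) - hB.eig k| ≤ χ) : x ∈ specNhd χ hB :=
  ⟨hB.isHermitian.eigenvalues k, ⟨k, rfl⟩, h⟩

theorem mulVec_col_eigU {H : Matrix (Fin n) (Fin n) ℂ} (hH : H.PosSemidef) (i : Fin n) :
    H *ᵥ hH.eigU.col i = ((hH.eig i : ℝ) : ℂ) • hH.eigU.col i := by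
  ext k
  have := congrFun (congrFun hH.mul_eigU k) i
  rw [Matrix.mul_diagonal] at this
  simpa [Matrix.mul_apply, Matrix.mulVec, dotProduct, mul_comm] using this

/-- The deterministic error bound for the sketched singular value transformation. -/
theorem norm_sketched_singularValueTransformation_sub_le {f : ℝ≥0 → ℂ} {L Lbar χ : ℝ}
    (hL : 0 ≤ L) (hLbar : 0 ≤ Lbar) {B : Matrix (Fin n) (Fin n) ℂ} (hB : B.PosSemidef)
    (hf : IsSmoothOn f L Lbar (specNhd χ hB)) {X : Matrix (Fin r) (Fin r) ℂ}
    (hX : X.PosSemidef) {G : Matrix (Fin n) (Fin n) ℂ} (hXG : X = R * G * Rᴴ)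
    (hχ : ‖Rᴴ * R - B‖ + ‖X - R * Rᴴ‖ ≤ χ) :
    ‖Rᴴ * singularValueTransformation (fbar f) hX * R - singularValueTransformation f hB‖ ≤
      Lbar * ‖R‖ ^ 2 * ‖X - R * Rᴴ‖ + L * ‖Rᴴ * R - B‖ := by
  have hY : (R * Rᴴ).PosSemidef := Matrix.posSemidef_self_mul_conjTranspose R
  have hZ : (Rᴴ * R).PosSemidef := Matrix.posSemidef_conjTranspose_mul_self R
  have hd1 := norm_nonneg (Rᴴ * R - B)
  have hd2 := norm_nonneg (X - R * Rᴴ)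
  have memB : ∀ k, hB.eig k ∈ specNhd χ hB := fun k =>
    mem_specNhd hB (k := k) (by rw [sub_self, abs_zero]; linarith)
  have memZ : ∀ i, hZ.eig i ∈ specNhd χ hB := by
    intro i
    have hne : hZ.eigU.col i ≠ 0 := by
      intro h
      have h1 := congrFun (congrFun hZ.conjTranspose_eigU_mul_eigU i) i
      have h2 : ∀ k, hZ.eigU k i = 0 := fun k => congrFun h k
      simp [Matrix.mul_apply, h2] at h1
    obtain ⟨k, -, hk⟩ := hB.exists_eig_near (Rᴴ * R) hne (mulVec_col_eigU hZ i)
    exact mem_specNhd hB (hk.trans (by linarith))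
  have memY : ∀ j, Rᴴ *ᵥ hY.eigU.col j ≠ 0 → hY.eig j ∈ specNhd χ hB := by
    intro j hj
    obtain ⟨k, hk⟩ := exists_eig_near_of_mul_conjTranspose R hB (mulVec_col_eigU hY j) hj
    exact mem_specNhd hB (hk.trans (by linarith))
  have memX : ∀ i, Rᴴ *ᵥ hX.eigU.col i ≠ 0 → hX.eig i ∈ specNhd χ hB := by
    intro i hi
    obtain ⟨j, hj, hj'⟩ := exists_eig_near_of_sandwich R hXG hY (mulVec_col_eigU hX i) hi
    obtain ⟨k, hk⟩ := exists_eig_near_of_mul_conjTranspose R hB (mulVec_col_eigU hY j) hj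
    refine mem_specNhd hB (k := k) ?_
    calc |(hX.eig i : ℝ) - hB.eig k|
        ≤ |(hX.eig i : ℝ) - hY.eig j| + |(hY.eig j : ℝ) - hB.eig k| := abs_sub_le _ _ _
      _ ≤ χ := by linarith
  have part1 : ‖singularValueTransformation f hZ - singularValueTransformation f hB‖ ≤
      L * ‖Rᴴ * R - B‖ :=
    hZ.norm_singularValueTransformation_sub_le hB hL fun i j =>
      hf.lipschitz _ (memZ i) _ (memB j)
  have part2 : ‖Rᴴ * (singularValueTransformation (fbar f) hX -
      singularValueTransformation (fbar f) hY) * R‖ ≤ Lbar * ‖R‖ ^ 2 * ‖X - R * Rᴴ‖ := by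
    classical
    set W := hX.eigUᴴ * hY.eigU with hW
    set N : Matrix (Fin r) (Fin r) ℂ := Matrix.of fun i j =>
      (fbar f (hX.eig i) - fbar f (hY.eig j)) * W i j with hN
    -- Erasing the rows and columns whose eigenvectors lie in ker R† does not change the sandwich,
    -- and leaves only eigenvalues at which f̄ is known to be Lipschitz.
    set N' : Matrix (Fin r) (Fin r) ℂ := Matrix.of fun i j =>
      if Rᴴ *ᵥ hX.eigU.col i ≠ 0 ∧ Rᴴ *ᵥ hY.eigU.col j ≠ 0 then N i j else 0 with hN'
    have hNN' : Rᴴ * hX.eigU * N * (hY.eigUᴴ * R) = Rᴴ * hX.eigU * N' * (hY.eigUᴴ * R) := by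
      ext a b
      simp only [Matrix.mul_apply (M := Rᴴ * hX.eigU * N),
        Matrix.mul_apply (M := Rᴴ * hX.eigU * N'), Matrix.mul_apply (N := N),
        Matrix.mul_apply (N := N'), Finset.sum_mul]
      refine Finset.sum_congr rfl fun j _ => Finset.sum_congr rfl fun i _ => ?_
      by_cases hi : Rᴴ *ᵥ hX.eigU.col i = 0
      · have : (Rᴴ * hX.eigU) a i = 0 := congrFun hi a
        rw [this]; simp
      by_cases hj : Rᴴ *ᵥ hY.eigU.col j = 0
      · have : (hY.eigUᴴ * R) j b = 0 := by
          have := congrArg star (congrFun hj b)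
          simpa [Matrix.mulVec, dotProduct, Matrix.mul_apply, mul_comm] using this
        rw [this]; simp
      · rw [hN', Matrix.of_apply, if_pos ⟨hi, hj⟩]
    have hN'le : ‖N'‖ ≤ Lbar * ‖X - R * Rᴴ‖ := by
      refine hX.norm_le_mul_norm_sub hY hLbar fun i j => ?_
      rw [hN', Matrix.of_apply]
      split_ifs with h
      · rw [hN, Matrix.of_apply, norm_mul]
        gcongr
        exact hf.lipschitz_fbar _ (memX i h.1) _ (memY j h.2)
      · rw [norm_zero]; positivity
    calc ‖Rᴴ * (singularValueTransformation (fbar f) hX -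
          singularValueTransformation (fbar f) hY) * R‖
        = ‖Rᴴ * hX.eigU * N * (hY.eigUᴴ * R)‖ := by
          rw [hX.singularValueTransformation_sub_eq hY]
          simp only [Matrix.mul_assoc, hN, hW]
      _ = ‖Rᴴ * (hX.eigU * N' * hY.eigUᴴ) * R‖ := by
          rw [hNN']; simp only [Matrix.mul_assoc]
      _ ≤ ‖Rᴴ‖ * ‖hX.eigU * N' * hY.eigUᴴ‖ * ‖R‖ :=
          (Matrix.frobenius_norm_mul _ _).trans
            (mul_le_mul_of_nonneg_right (Matrix.frobenius_norm_mul _ _) (norm_nonneg _))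
      _ = ‖R‖ ^ 2 * ‖N'‖ := by
          rw [frobenius_norm_mul_conjTranspose_of_conjTranspose_mul_self
              hY.conjTranspose_eigU_mul_eigU,
            frobenius_norm_mul_of_conjTranspose_mul_self hX.conjTranspose_eigU_mul_eigU,
            Matrix.frobenius_norm_conjTranspose]
          ring
      _ ≤ ‖R‖ ^ 2 * (Lbar * ‖X - R * Rᴴ‖) := by gcongr
      _ = _ := by ring
  have hsplit : Rᴴ * singularValueTransformation (fbar f) hX * R -
      singularValueTransformation f hB =
      Rᴴ * (singularValueTransformation (fbar f) hX -
        singularValueTransformation (fbar f) hY) * R +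
      (singularValueTransformation f hZ - singularValueTransformation f hB) := by
    rw [Matrix.mul_sub, Matrix.sub_mul,
      conjTranspose_mul_singularValueTransformation_mul R f (fbar f)
        (mul_fbar hf.map_zero) hY hZ]
    abel
  rw [hsplit]
  exact (norm_add_le _ _).trans (add_le_add part2 part1)

end Sandwich

/-! ### Concentration of importance sketches. -/

section Sampling

variable {r m n : ℕ}

/-- The squared `ℓ₂` norm of a row. -/
noncomputable def rowSq (A : Matrix (Fin m) (Fin n) ℂ) (i : Fin m) : ℝ := ∑ j, ‖A i j‖ ^ 2

theorem rowSq_nonneg (A : Matrix (Fin m) (Fin n) ℂ) (i : Fin m) : 0 ≤ rowSq A i :=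
  Finset.sum_nonneg fun _ _ => sq_nonneg _

/-- The rescaled outer product `A(i,·)† A(i,·) / p(i)`. -/
noncomputable def rowGram (p : Fin m → ℝ) (A : Matrix (Fin m) (Fin n) ℂ) (i : Fin m) :
    Matrix (Fin n) (Fin n) ℂ :=
  (((p i)⁻¹ : ℝ) : ℂ) • Matrix.vecMulVec (star (A i)) (A i)

theorem norm_rowGram {p : Fin m → ℝ} (hp : ∀ i, 0 ≤ p i) (A : Matrix (Fin m) (Fin n) ℂ)
    (i : Fin m) : ‖rowGram p A i‖ = (p i)⁻¹ * rowSq A i := by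
  have h : ‖Matrix.vecMulVec (star (A i)) (A i)‖ = rowSq A i := by
    refine (sq_eq_sq₀ (norm_nonneg _) (rowSq_nonneg A i)).1 ?_
    rw [frobenius_norm_sq, sq (rowSq A i), rowSq, Finset.sum_mul_sum]
    simp [Matrix.vecMulVec_apply, mul_pow]
  rw [rowGram, norm_smul, Complex.norm_real, Real.norm_of_nonneg (inv_nonneg.2 (hp i)), h]

theorem sketchR_sampleMatrix_apply (p : Fin m → ℝ) (s : Fin r → Fin m)
    (A : Matrix (Fin m) (Fin n) ℂ) (k : Fin r) (j : Fin n) :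
    sketchR (sampleMatrix p s) A k j =
      ((if 0 < p (s k) then 1 / √((r : ℝ) * p (s k)) else 0 : ℝ) : ℂ) * A (s k) j := by
  rw [sketchR, Matrix.mul_apply, Finset.sum_eq_single (s k)]
  · simp [sampleMatrix]
  · intro b _ hb
    simp [sampleMatrix, hb]
  · simp

theorem sq_sampling_weight {p : Fin m → ℝ} (hp : ∀ i, 0 ≤ p i) (i : Fin m) :
    (if 0 < p i then 1 / √((r : ℝ) * p i) else 0) ^ 2 = (r : ℝ)⁻¹ * (p i)⁻¹ := by
  split_ifs with h
  · rw [div_pow, Real.sq_sqrt (mul_nonneg (Nat.cast_nonneg _) (hp i)), one_pow, one_div, mul_inv]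
  · rw [le_antisymm (not_lt.1 h) (hp i)]; simp

theorem conjTranspose_sketchR_mul_sketchR {p : Fin m → ℝ} (hp : ∀ i, 0 ≤ p i)
    (s : Fin r → Fin m) (A : Matrix (Fin m) (Fin n) ℂ) :
    (sketchR (sampleMatrix p s) A)ᴴ * sketchR (sampleMatrix p s) A =
      (((r : ℝ)⁻¹ : ℝ) : ℂ) • ∑ k, rowGram p A (s k) := by
  ext a b
  rw [Matrix.mul_apply, Matrix.smul_apply, Matrix.sum_apply, smul_eq_mul, Finset.mul_sum]
  refine Finset.sum_congr rfl fun k _ => ?_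
  have h := congrArg (fun x : ℝ => (x : ℂ)) (sq_sampling_weight (r := r) hp (s k))
  simp only [Complex.ofReal_mul, Complex.ofReal_pow] at h
  rw [Matrix.conjTranspose_apply, sketchR_sampleMatrix_apply, sketchR_sampleMatrix_apply,
    rowGram, Matrix.smul_apply, Matrix.vecMulVec_apply, star_mul', Complex.star_def,
    Complex.conj_ofReal, smul_eq_mul, Pi.star_apply, Complex.star_def]
  linear_combination ((starRingEnd ℂ) (A (s k) a) * A (s k) b) * h

theorem norm_sketchR_sq {p : Fin m → ℝ} (hp : ∀ i, 0 ≤ p i)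
    (s : Fin r → Fin m) (A : Matrix (Fin m) (Fin n) ℂ) :
    ‖sketchR (sampleMatrix p s) A‖ ^ 2 = (r : ℝ)⁻¹ * ∑ k, (p (s k))⁻¹ * rowSq A (s k) := by
  rw [frobenius_norm_sq, Finset.mul_sum]
  refine Finset.sum_congr rfl fun k _ => ?_
  rw [← mul_assoc, ← sq_sampling_weight (r := r) hp (s k), rowSq, Finset.mul_sum]
  refine Finset.sum_congr rfl fun j _ => ?_
  rw [sketchR_sampleMatrix_apply, norm_mul, mul_pow, Complex.norm_real, Real.norm_eq_abs, sq_abs]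

variable {A : Matrix (Fin m) (Fin n) ℂ} {p pt : Fin m → ℝ} {ε φ : ℝ}

theorem rowSq_le_of_rowDist_le (hA : A ≠ 0) (hφ : 0 < φ)
    (hrow : ∀ i, (1 / φ) * rowDist A i ≤ p i) (i : Fin m) :
    rowSq A i ≤ φ * ‖A‖ ^ 2 * p i := by
  have hA' : 0 < ‖A‖ := norm_pos_iff.2 hA
  have h : 1 / φ * (rowSq A i / ‖A‖ ^ 2) ≤ p i := hrow i
  rw [one_div, inv_mul_le_iff₀ hφ, div_le_iff₀ (by positivity)] at h
  linarith

/-- Where p(i) = 0, the lower bound on p forces the row to vanish, so the convention `0⁻¹ = 0` loses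
no mass. -/
theorem mul_inv_mul_rowSq (hp : ∀ i, 0 ≤ p i) (hA : A ≠ 0) (hφ : 0 < φ)
    (hrow : ∀ i, (1 / φ) * rowDist A i ≤ p i) (i : Fin m) :
    p i * ((p i)⁻¹ * rowSq A i) = rowSq A i := by
  rcases (hp i).eq_or_lt with h | h
  · have h1 := rowSq_le_of_rowDist_le hA hφ hrow i
    rw [← h, mul_zero] at h1
    simp [le_antisymm h1 (rowSq_nonneg A i)]
  · field_simp

theorem inv_mul_rowSq_le (hp : ∀ i, 0 ≤ p i) (hA : A ≠ 0) (hφ : 0 < φ)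
    (hrow : ∀ i, (1 / φ) * rowDist A i ≤ p i) (i : Fin m) :
    (p i)⁻¹ * rowSq A i ≤ φ * ‖A‖ ^ 2 := by
  rcases (hp i).eq_or_lt with h | h
  · rw [← h]; simp; positivity
  · rw [inv_mul_le_iff₀ h, mul_comm (p i)]
    exact rowSq_le_of_rowDist_le hA hφ hrow i

theorem sum_smul_rowGram (hp : ∀ i, 0 ≤ p i) (hA : A ≠ 0) (hφ : 0 < φ)
    (hrow : ∀ i, (1 / φ) * rowDist A i ≤ p i) :
    ∑ i, (p i : ℂ) • rowGram p A i = Aᴴ * A := by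
  ext a b
  rw [Matrix.sum_apply, Matrix.mul_apply]
  refine Finset.sum_congr rfl fun i _ => ?_
  rw [rowGram, Matrix.smul_apply, Matrix.smul_apply, Matrix.vecMulVec_apply, smul_eq_mul,
    smul_eq_mul, Matrix.conjTranspose_apply, Pi.star_apply]
  rcases (hp i).eq_or_lt with h | h
  · have h1 := rowSq_le_of_rowDist_le hA hφ hrow i
    rw [← h, mul_zero] at h1
    have h2 : ‖A i b‖ ^ 2 ≤ rowSq A i :=
      Finset.single_le_sum (f := fun j => ‖A i j‖ ^ 2) (fun j _ => sq_nonneg _)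
        (Finset.mem_univ b)
    have h3 : A i b = 0 := by
      have : ‖A i b‖ ^ 2 = 0 := le_antisymm (h2.trans h1) (sq_nonneg _)
      simpa using this
    simp [h3]
  · have : (p i : ℂ) ≠ 0 := by exact_mod_cast h.ne'
    push_cast
    field_simp

theorem sum_abs_sub_le_of_tvDist_le (h : tvDist pt p ≤ ε) : ∑ i, |pt i - p i| ≤ 2 * ε := by
  rw [tvDist] at h; linarith

/-- The bias of drawing from `pt` while rescaling by `p`: the ℓ₁ distance 2ε times the uniform bound
φ‖A‖² on the summands. -/
theorem norm_sum_smul_rowGram_sub_le (hp : ∀ i, 0 ≤ p i) (hA : A ≠ 0) (hφ : 0 < φ)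
    (hrow : ∀ i, (1 / φ) * rowDist A i ≤ p i) (htv : tvDist pt p ≤ ε) :
    ‖∑ i, (pt i : ℂ) • rowGram p A i - Aᴴ * A‖ ≤ 2 * ε * (φ * ‖A‖ ^ 2) := by
  rw [← sum_smul_rowGram hp hA hφ hrow, ← Finset.sum_sub_distrib]
  calc ‖∑ i, ((pt i : ℂ) • rowGram p A i - (p i : ℂ) • rowGram p A i)‖
      ≤ ∑ i, |pt i - p i| * (φ * ‖A‖ ^ 2) := by
        refine norm_sum_le_of_le _ fun i _ => ?_
        rw [← sub_smul, norm_smul, ← Complex.ofReal_sub, Complex.norm_real, Real.norm_eq_abs,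
          norm_rowGram hp]
        exact mul_le_mul_of_nonneg_left (inv_mul_rowSq_le hp hA hφ hrow i) (abs_nonneg _)
    _ = (∑ i, |pt i - p i|) * (φ * ‖A‖ ^ 2) := by rw [Finset.sum_mul]
    _ ≤ _ := by
        gcongr
        exact sum_abs_sub_le_of_tvDist_le htv

theorem sum_mul_inv_mul_rowSq_le (hp : ∀ i, 0 ≤ p i) (hA : A ≠ 0) (hφ : 0 < φ)
    (hrow : ∀ i, (1 / φ) * rowDist A i ≤ p i) (htv : tvDist pt p ≤ ε) :
    ∑ i, pt i * ((p i)⁻¹ * rowSq A i) ≤ ‖A‖ ^ 2 + 2 * ε * (φ * ‖A‖ ^ 2) := by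
  have h1 : ∑ i, p i * ((p i)⁻¹ * rowSq A i) = ‖A‖ ^ 2 := by
    rw [frobenius_norm_sq]
    exact Finset.sum_congr rfl fun i _ => mul_inv_mul_rowSq hp hA hφ hrow i
  have h2 : ∑ i, (pt i - p i) * ((p i)⁻¹ * rowSq A i) ≤ 2 * ε * (φ * ‖A‖ ^ 2) := by
    calc ∑ i, (pt i - p i) * ((p i)⁻¹ * rowSq A i)
        ≤ ∑ i, |pt i - p i| * (φ * ‖A‖ ^ 2) := by
          refine Finset.sum_le_sum fun i _ => ?_
          have h0 : 0 ≤ (p i)⁻¹ * rowSq A i :=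
            mul_nonneg (inv_nonneg.2 (hp i)) (rowSq_nonneg A i)
          exact mul_le_mul (le_abs_self _) (inv_mul_rowSq_le hp hA hφ hrow i) h0 (abs_nonneg _)
      _ = (∑ i, |pt i - p i|) * (φ * ‖A‖ ^ 2) := by rw [Finset.sum_mul]
      _ ≤ _ := by
          gcongr
          exact sum_abs_sub_le_of_tvDist_le htv
  have h3 : ∑ i, pt i * ((p i)⁻¹ * rowSq A i) = ∑ i, p i * ((p i)⁻¹ * rowSq A i) +
      ∑ i, (pt i - p i) * ((p i)⁻¹ * rowSq A i) := by
    rw [← Finset.sum_add_distrib]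
    exact Finset.sum_congr rfl fun i _ => by ring
  linarith

/-- The Frobenius norm as a Hilbert space norm. -/
noncomputable def flattenL2 :
    Matrix (Fin m) (Fin n) ℂ →ₗ[ℂ] EuclideanSpace ℂ (Fin m × Fin n) where
  toFun M := WithLp.toLp 2 fun x => M x.1 x.2
  map_add' _ _ := rfl
  map_smul' _ _ := rfl

theorem norm_flattenL2 (M : Matrix (Fin m) (Fin n) ℂ) : ‖flattenL2 M‖ = ‖M‖ := by
  refine (sq_eq_sq₀ (norm_nonneg _) (norm_nonneg _)).1 ?_
  rw [frobenius_norm_sq, EuclideanSpace.norm_sq_eq, Fintype.sum_prod_type]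
  rfl

variable {Ω : Type*} [MeasurableSpace Ω] {P : Measure Ω}

open Classical in
/-- The probability of an event determined by independent samples, as a finite sum. -/
theorem measure_samples_le (hpt : ∀ i, 0 ≤ pt i) {s : Fin r → Ω → Fin m}
    (hind : iIndepFun s P) (hlaw : ∀ i j, P {ω | s i ω = j} = ENNReal.ofReal (pt j))
    (Q : (Fin r → Fin m) → Prop) :
    P {ω | Q fun k => s k ω} ≤
      ENNReal.ofReal (∑ t : Fin r → Fin m, if Q t then ∏ k, pt (t k) else 0) := by
  have hsub : {ω | Q fun k => s k ω} ⊆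
      ⋃ t ∈ Finset.univ.filter Q, ⋂ k ∈ (Finset.univ : Finset (Fin r)), s k ⁻¹' {t k} := by
    intro ω hω
    simp only [Set.mem_iUnion, Set.mem_iInter]
    exact ⟨fun k => s k ω, by simpa using hω, fun k _ => rfl⟩
  refine (measure_mono hsub).trans ((measure_biUnion_finset_le _ _).trans (le_of_eq ?_))
  rw [← Finset.sum_filter, ENNReal.ofReal_sum_of_nonneg fun t _ =>
    Finset.prod_nonneg fun k _ => hpt _]
  refine Finset.sum_congr rfl fun t _ => ?_
  rw [hind.measure_inter_preimage_eq_mul Finset.univ (sets := fun k => {t k})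
    fun k _ => MeasurableSet.singleton _, ENNReal.ofReal_prod_of_nonneg fun k _ => hpt _]
  exact Finset.prod_congr rfl fun k _ => hlaw k (t k)

/-- An approximate importance sketch approximates the Gram matrix in Frobenius norm. -/
theorem measure_gram_sketch_le {S : Ω → Matrix (Fin r) (Fin m) ℝ} (hA : A ≠ 0) (hφ : 1 ≤ φ)
    (hr : 1 ≤ r) (hS : IsApproxImportanceSketch P ε φ A S) {l : ℝ} (hl : 0 ≤ l) :
    P {ω | 2 * ε * (φ * ‖A‖ ^ 2) + φ * ‖A‖ ^ 2 * √(8 * l / r) <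
      ‖(sketchR (S ω) A)ᴴ * sketchR (S ω) A - Aᴴ * A‖} ≤ ENNReal.ofReal (2 * Real.exp (-l)) := by
  classical
  obtain ⟨p, hp, pt, hpt, hrow, htv, s, -, hind, hlaw, hae⟩ := hS
  have hφ0 : 0 < φ := by linarith
  have hM : 0 < φ * ‖A‖ ^ 2 := by
    have := norm_pos_iff.2 hA
    positivity
  have hr0 : (0 : ℝ) < r := by exact_mod_cast hr
  set M := φ * ‖A‖ ^ 2 with hMdef
  set X := rowGram p A
  set μ := ∑ i, (pt i : ℂ) • X i with hμ
  have hX : ∀ i, ‖X i‖ ≤ M := fun i => by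
    rw [norm_rowGram hp.1]; exact inv_mul_rowSq_le hp.1 hA hφ0 hrow i
  have hμM : ‖μ‖ ≤ M := by
    calc ‖μ‖ ≤ ∑ i, pt i * M := by
          refine norm_sum_le_of_le _ fun i _ => ?_
          rw [norm_smul, Complex.norm_real, Real.norm_of_nonneg (hpt.1 i)]
          exact mul_le_mul_of_nonneg_left (hX i) (hpt.1 i)
      _ = M := by rw [← Finset.sum_mul, hpt.2, one_mul]
  -- The centred summands have norm at most 2M, so this threshold makes the Pinelis exponent τ² /
  -- (2r(2M)²) equal to l.
  set τ := M * √(8 * l * r) with hτ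
  have hτr : (r : ℝ)⁻¹ * τ = M * √(8 * l / r) := by
    have : √(8 * l * r) = r * √(8 * l / r) := by
      rw [← Real.sqrt_sq hr0.le, ← Real.sqrt_mul (sq_nonneg _), Real.sqrt_sq hr0.le]
      congr 1
      field_simp
    rw [hτ, this]
    field_simp
  have pin := sum_prod_le_two_mul_exp hpt.1 hpt.2 (Y := fun i => flattenL2 (X i - μ))
    (by
      have h1 : ∑ i, (pt i : ℂ) = 1 := by exact_mod_cast hpt.2
      rw [← map_zero (flattenL2 (m := n) (n := n))]
      simp only [← map_smul, ← map_sum, smul_sub, Finset.sum_sub_distrib, ← Finset.sum_smul, h1,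
        one_smul, ← hμ, sub_self])
    (c := 2 * M) (by positivity)
    (fun i => by
      rw [norm_flattenL2]
      exact (norm_sub_le _ _).trans (by linarith [hX i]))
    (k := r) hr (τ := τ) (by positivity)
  have hexp : τ ^ 2 / (2 * r * (2 * M) ^ 2) = l := by
    rw [hτ, mul_pow, Real.sq_sqrt (by positivity)]
    field_simp
    ring
  rw [hexp] at pin
  refine le_trans ?_ (ENNReal.ofReal_le_ofReal pin)
  refine le_trans (measure_mono_ae ?_) (measure_samples_le hpt.1 hind hlaw
    fun t => τ ≤ ‖∑ j, flattenL2 (X (t j) - μ)‖)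
  filter_upwards [hae] with ω hω hlt
  change _ < _ at hlt
  change _ ≤ _
  rw [← map_sum, norm_flattenL2, Finset.sum_sub_distrib]
  by_contra! hcon
  refine absurd hlt (not_lt.2 ?_)
  rw [hω, conjTranspose_sketchR_mul_sketchR hp.1]
  have hdec : (((r : ℝ)⁻¹ : ℝ) : ℂ) • ∑ k, X (s k ω) - Aᴴ * A =
      (μ - Aᴴ * A) + (((r : ℝ)⁻¹ : ℝ) : ℂ) • (∑ k, X (s k ω) - ∑ _k : Fin r, μ) := by
    have : (((r : ℝ)⁻¹ : ℝ) : ℂ) • ∑ _k : Fin r, μ = μ := by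
      rw [Finset.sum_const, Finset.card_univ, Fintype.card_fin, ← Nat.cast_smul_eq_nsmul ℂ,
        smul_smul]
      have : (r : ℂ) ≠ 0 := by exact_mod_cast hr0.ne'
      push_cast
      rw [inv_mul_cancel₀ this, one_smul]
    rw [smul_sub, this]
    abel
  change ‖(((r : ℝ)⁻¹ : ℝ) : ℂ) • ∑ k, X (s k ω) - Aᴴ * A‖ ≤ _
  rw [hdec]
  refine (norm_add_le _ _).trans (add_le_add
    (norm_sum_smul_rowGram_sub_le hp.1 hA hφ0 hrow htv) ?_)
  rw [norm_smul, Complex.norm_real, Real.norm_of_nonneg (by positivity), ← hτr]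
  gcongr

/-- The Frobenius norm of an approximate importance sketch is controlled. -/
theorem measure_norm_sketch_le [IsProbabilityMeasure P] {S : Ω → Matrix (Fin r) (Fin m) ℝ}
    (hA : A ≠ 0) (hφ : 1 ≤ φ) (hr : 1 ≤ r) (hS : IsApproxImportanceSketch P ε φ A S)
    {l : ℝ} (hl : 0 ≤ l) :
    P {ω | ‖A‖ ^ 2 + 2 * ε * (φ * ‖A‖ ^ 2) + φ * ‖A‖ ^ 2 * √(l / (2 * r)) <
      ‖sketchR (S ω) A‖ ^ 2} ≤ ENNReal.ofReal (Real.exp (-l)) := by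
  obtain ⟨p, hp, pt, hpt, hrow, htv, s, hsm, hind, hlaw, hae⟩ := hS
  have hφ0 : 0 < φ := by linarith
  have hM : 0 < φ * ‖A‖ ^ 2 := by
    have := norm_pos_iff.2 hA
    positivity
  have hr0 : (0 : ℝ) < r := by exact_mod_cast hr
  set M := φ * ‖A‖ ^ 2 with hMdef
  set g : Fin m → ℝ := fun i => (p i)⁻¹ * rowSq A i with hg
  have hg0 : ∀ i, 0 ≤ g i := fun i => mul_nonneg (inv_nonneg.2 (hp.1 i)) (rowSq_nonneg A i)
  have hgM : ∀ i, g i ≤ M := fun i => inv_mul_rowSq_le hp.1 hA hφ0 hrow i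
  have hgm : Measurable g := measurable_of_countable g
  have hmean : ∀ k, ∫ ω, g (s k ω) ∂P = ∑ j, pt j * g j := by
    intro k
    have : IsProbabilityMeasure (P.map (s k)) := Measure.isProbabilityMeasure_map (hsm k).aemeasurable
    rw [← integral_map (hsm k).aemeasurable hgm.aestronglyMeasurable,
      integral_fintype (Integrable.of_finite)]
    refine Finset.sum_congr rfl fun j _ => ?_
    rw [smul_eq_mul, Measure.real, Measure.map_apply (hsm k) (MeasurableSet.singleton j)]
    have := hlaw k j
    change P (s k ⁻¹' {j}) = _ at this
    rw [this, ENNReal.toReal_ofReal (hpt.1 j)]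
  set μ := ∑ j, pt j * g j with hμ
  have hsub : ∀ k ∈ (Finset.univ : Finset (Fin r)),
      HasSubgaussianMGF (fun ω => g (s k ω) - μ) ((‖M - 0‖₊ / 2) ^ 2) P := by
    intro k _
    have := hasSubgaussianMGF_of_mem_Icc (μ := P) (X := fun ω => g (s k ω)) (a := 0) (b := M)
      (hgm.comp (hsm k)).aemeasurable (ae_of_all _ fun ω => ⟨hg0 _, hgM _⟩)
    rwa [hmean k] at this
  have hind' : iIndepFun (fun k ω => g (s k ω) - μ) P :=
    hind.comp (fun _ i => g i - μ) fun _ => measurable_of_countable _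
  -- Summands in [0, M] have variance proxy M²/4, so the Hoeffding exponent 2τ² / (rM²) equals l.
  set τ := (r : ℝ) * (M * √(l / (2 * r))) with hτ
  have hoeff := HasSubgaussianMGF.measure_sum_ge_le_of_iIndepFun hind' hsub
    (ε := τ) (by positivity)
  have hexp : -τ ^ 2 / (2 * ((∑ _k : Fin r, (‖M - 0‖₊ / 2) ^ 2 : ℝ≥0) : ℝ)) = -l := by
    have h2 : (‖M - 0‖₊ : ℝ) = M := by simp [abs_of_pos hM]
    rw [Finset.sum_const, Finset.card_univ, Fintype.card_fin]
    push_cast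
    rw [nsmul_eq_mul, ← coe_nnnorm, h2, hτ, mul_pow, mul_pow, Real.sq_sqrt (by positivity)]
    field_simp
  have hoeff' : P {ω | τ ≤ ∑ k, (g (s k ω) - μ)} ≤ ENNReal.ofReal (Real.exp (-l)) := by
    rw [← ENNReal.ofReal_toReal (measure_ne_top P {ω | τ ≤ ∑ k, (g (s k ω) - μ)})]
    refine ENNReal.ofReal_le_ofReal (hoeff.trans (le_of_eq ?_))
    rw [← hexp]
  refine le_trans (measure_mono_ae ?_) hoeff'
  filter_upwards [hae] with ω hω hlt
  change _ < _ at hlt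
  change _ ≤ _
  rw [hω, norm_sketchR_sq hp.1] at hlt
  have hμle : μ ≤ ‖A‖ ^ 2 + 2 * ε * M := sum_mul_inv_mul_rowSq_le hp.1 hA hφ0 hrow htv
  have h1 : μ + M * √(l / (2 * r)) < (r : ℝ)⁻¹ * ∑ k, g (s k ω) :=
    lt_of_le_of_lt (by linarith) hlt
  rw [lt_inv_mul_iff₀ hr0] at h1
  rw [Finset.sum_sub_distrib, Finset.sum_const, Finset.card_univ, Fintype.card_fin, nsmul_eq_mul]
  linarith

end Sampling

/-- The square of the left side is at most (8/112) t² = t²/14, and 3/11 is a rational slightly above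
1/√14. -/
theorem mul_sqrt_le_of_sample_size {M l t : ℝ} (ht : 0 < t) (hM : 0 ≤ M) (hl : 0 ≤ l) {k : ℕ}
    (hk : 1 ≤ k) (h : 112 * M ^ 2 * (l / t ^ 2) ≤ k) : M * √(8 * l / k) ≤ 3 / 11 * t := by
  have hk0 : (0 : ℝ) < k := by exact_mod_cast hk
  refine (sq_le_sq₀ (by positivity) (by positivity)).1 ?_
  rw [mul_pow, Real.sq_sqrt (by positivity), mul_div_assoc', div_le_iff₀ hk0]
  rw [mul_div_assoc', div_le_iff₀ (by positivity)] at h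
  nlinarith [mul_nonneg hk0.le (sq_nonneg t)]

/-! ### The second sketch, conditioned on the first. -/

section Final

variable {m n r c : ℕ} {A : Matrix (Fin m) (Fin n) ℂ}

theorem sketchC_eq_sketchR_mul (S : Matrix (Fin r) (Fin m) ℝ) (A : Matrix (Fin m) (Fin n) ℂ)
    (T : Matrix (Fin c) (Fin n) ℝ) :
    sketchC S A T = sketchR S A * (T.map Complex.ofReal)ᴴ := rfl

/-- Exhibits CC† as the Gram matrix of the sketch of R†, so that the first concentration bound
applies again. -/
theorem sketchC_mul_conjTranspose (S : Matrix (Fin r) (Fin m) ℝ) (T : Matrix (Fin c) (Fin n) ℝ) :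
    sketchC S A T * (sketchC S A T)ᴴ =
      (sketchR T (sketchR S A)ᴴ)ᴴ * sketchR T (sketchR S A)ᴴ := by
  simp only [sketchC, sketchR, Matrix.conjTranspose_mul, Matrix.conjTranspose_conjTranspose]

/-- Integrating the conditional error bound for the second sketch over the first sketch. -/
theorem measure_second_sketch_le {Ω : Type*} [MeasurableSpace Ω] {P : Measure Ω}
    [IsProbabilityMeasure P] {ε φ φ' : ℝ} (hφ' : 1 ≤ φ') (hc : 1 ≤ c)
    {S : Ω → Matrix (Fin r) (Fin m) ℝ} {T : Ω → Matrix (Fin c) (Fin n) ℝ}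
    (hSmeas : ∀ i j, Measurable fun ω => S ω i j)
    (hS : IsApproxImportanceSketch P ε φ A S)
    (hT : ∀ S₀ : Matrix (Fin r) (Fin m) ℝ, P (S ⁻¹' {S₀}) ≠ 0 → sketchR S₀ A ≠ 0 →
      IsApproxImportanceSketch (P[|S ⁻¹' {S₀}]) ε φ' (sketchR S₀ A)ᴴ T)
    {l : ℝ} (hl : 0 ≤ l) :
    P {ω | 2 * ε * (φ' * ‖sketchR (S ω) A‖ ^ 2) + φ' * ‖sketchR (S ω) A‖ ^ 2 * √(8 * l / c) <
      ‖sketchC (S ω) A (T ω) * (sketchC (S ω) A (T ω))ᴴ -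
        sketchR (S ω) A * (sketchR (S ω) A)ᴴ‖} ≤ ENNReal.ofReal (2 * Real.exp (-l)) := by
  classical
  obtain ⟨p, -, -, -, -, -, s, -, -, -, hae⟩ := hS
  set b : ℝ≥0∞ := ENNReal.ofReal (2 * Real.exp (-l)) with hb
  set bad : Matrix (Fin r) (Fin m) ℝ → Set Ω := fun S₀ =>
    {ω | 2 * ε * (φ' * ‖sketchR S₀ A‖ ^ 2) + φ' * ‖sketchR S₀ A‖ ^ 2 * √(8 * l / c) <
      ‖sketchC S₀ A (T ω) * (sketchC S₀ A (T ω))ᴴ - sketchR S₀ A * (sketchR S₀ A)ᴴ‖} with hbad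
  have hmeas : ∀ S₀, MeasurableSet (S ⁻¹' {S₀}) := by
    intro S₀
    have : S ⁻¹' {S₀} = ⋂ i, ⋂ j, (fun ω => S ω i j) ⁻¹' {S₀ i j} := by
      ext ω
      simp only [Set.mem_preimage, Set.mem_singleton_iff, Set.mem_iInter]
      exact ⟨fun h i j => by rw [h], fun h => Matrix.ext h⟩
    rw [this]
    exact MeasurableSet.iInter fun i => MeasurableSet.iInter fun j =>
      hSmeas i j (MeasurableSet.singleton _)
  have hone : ∀ S₀, P (S ⁻¹' {S₀} ∩ bad S₀) ≤ b * P (S ⁻¹' {S₀}) := by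
    intro S₀
    by_cases h0 : P (S ⁻¹' {S₀}) = 0
    · exact (measure_mono Set.inter_subset_left).trans (by rw [h0]; simp)
    -- When R = 0 nothing is known about T, but both sides of the strict inequality vanish and the
    -- bad event is empty.
    by_cases hR : sketchR S₀ A = 0
    · have : bad S₀ = ∅ := by
        ext ω
        have hC : sketchC S₀ A (T ω) = 0 := by
          rw [sketchC_eq_sketchR_mul, hR, Matrix.zero_mul]
        simp [hbad, hC, hR]
      rw [this]; simp
    · have : IsProbabilityMeasure (P[|S ⁻¹' {S₀}]) := cond_isProbabilityMeasure h0
      have hR' : (sketchR S₀ A)ᴴ ≠ 0 := by simpa using hR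
      have key := measure_gram_sketch_le hR' hφ' hc (hT S₀ h0 hR) hl
      simp only [Matrix.frobenius_norm_conjTranspose, Matrix.conjTranspose_conjTranspose,
        ← sketchC_mul_conjTranspose] at key
      rw [← cond_mul_eq_inter (hmeas S₀)]
      gcongr
  -- Almost surely S takes one of these finitely many values, so conditioning reduces to a sum over
  -- atoms.
  set F : Finset (Matrix (Fin r) (Fin m) ℝ) := Finset.univ.image (sampleMatrix (r := r) p) with hF
  calc P {ω | 2 * ε * (φ' * ‖sketchR (S ω) A‖ ^ 2) +
          φ' * ‖sketchR (S ω) A‖ ^ 2 * √(8 * l / c) <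
        ‖sketchC (S ω) A (T ω) * (sketchC (S ω) A (T ω))ᴴ -
          sketchR (S ω) A * (sketchR (S ω) A)ᴴ‖}
      ≤ P (⋃ S₀ ∈ F, S ⁻¹' {S₀} ∩ bad S₀) := by
        refine measure_mono_ae ?_
        filter_upwards [hae] with ω hω hlt
        have hF' : S ω ∈ F := by
          rw [hω]; exact Finset.mem_image_of_mem _ (Finset.mem_univ _)
        have h1 : ω ∈ S ⁻¹' {S ω} := Set.mem_preimage.2 (Set.mem_singleton _)
        have h2 : ω ∈ bad (S ω) := Set.mem_ofPred.2 (Set.mem_ofPred.1 hlt)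
        exact Set.mem_biUnion (s := (F : Set _)) (t := fun S₀ => S ⁻¹' {S₀} ∩ bad S₀)
          (Finset.mem_coe.2 hF') (Set.mem_inter h1 h2)
    _ ≤ ∑ S₀ ∈ F, P (S ⁻¹' {S₀} ∩ bad S₀) := measure_biUnion_finset_le _ _
    _ ≤ ∑ S₀ ∈ F, b * P (S ⁻¹' {S₀}) := Finset.sum_le_sum fun S₀ _ => hone S₀
    _ = b * P (⋃ S₀ ∈ F, S ⁻¹' {S₀}) := by
        rw [← Finset.mul_sum, measure_biUnion_finset
          (fun x _ y _ hxy => Disjoint.preimage S (Set.disjoint_singleton.2 hxy))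
          fun S₀ _ => hmeas S₀]
    _ ≤ b := by
        calc b * P (⋃ S₀ ∈ F, S ⁻¹' {S₀}) ≤ b * 1 := by gcongr; exact prob_le_one
          _ = b := mul_one b

end Final

/-! ### Constants and union bound. -/

theorem theorem3 {m n : ℕ} (A : Matrix (Fin m) (Fin n) ℂ) (hA : A ≠ 0)
    (f : ℝ≥0 → ℂ) (L Lbar χ : ℝ) (hL : 0 < L) (hLbar : 0 < Lbar) (hχ : 0 < χ)
    (hf : IsSmoothOn f L Lbar (specNhd χ (Matrix.posSemidef_conjTranspose_mul_self A)))
    (δ γ φ φ' ε : ℝ) (hδ : 0 < δ) (hδ1 : δ ≤ 1) (hγ : 0 < γ) (hφ : 1 ≤ φ) (hφ' : 1 ≤ φ')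
    (hε : 0 ≤ ε) (r c : ℕ) (hr : 1 ≤ r) (hrm : r ≤ m) (hc : 1 ≤ c) (hcn : c ≤ n)
    (cond_ε : ε ≤ min (min (1 / (8 * φ)) (χ / (24 * (φ + φ') * ‖A‖ ^ 2)))
      (min (γ / (24 * L * φ * ‖A‖ ^ 2)) (γ / (48 * Lbar * φ' * ‖A‖ ^ 4))))
    (cond_r : max (2 * φ ^ 2 * Real.log (6 / δ))
      (112 * φ ^ 2 * ‖A‖ ^ 4 *
        (Real.log (6 / δ) / χ ^ 2 + Real.log (6 / δ) * L ^ 2 / γ ^ 2)) ≤ (r : ℝ))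
    (cond_c : 112 * φ' ^ 2 * ‖A‖ ^ 4 *
        (Real.log (6 / δ) / χ ^ 2 + 4 * Real.log (6 / δ) * Lbar ^ 2 * ‖A‖ ^ 4 / γ ^ 2) ≤ (c : ℝ))
    {Ω : Type*} [MeasurableSpace Ω] (P : Measure Ω) [IsProbabilityMeasure P]
    (S : Ω → Matrix (Fin r) (Fin m) ℝ) (T : Ω → Matrix (Fin c) (Fin n) ℝ)
    (hSmeas : ∀ i j, Measurable fun ω => S ω i j) (hTmeas : ∀ i j, Measurable fun ω => T ω i j)
    (hS : IsApproxImportanceSketch P ε φ A S)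
    (hT : ∀ S₀ : Matrix (Fin r) (Fin m) ℝ, P (S ⁻¹' {S₀}) ≠ 0 → sketchR S₀ A ≠ 0 →
      IsApproxImportanceSketch (P[|S ⁻¹' {S₀}]) ε φ' (sketchR S₀ A)ᴴ T) :
    ENNReal.ofReal (1 - δ) ≤
      P {ω | ‖(sketchR (S ω) A)ᴴ *
            singularValueTransformation (fbar f)
              (Matrix.posSemidef_self_mul_conjTranspose (sketchC (S ω) A (T ω))) *
            sketchR (S ω) A -
          singularValueTransformation f (Matrix.posSemidef_conjTranspose_mul_self A)‖ ≤ γ} := by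
  have ha : 0 < ‖A‖ ^ 2 := by
    have := norm_pos_iff.2 hA
    positivity
  have hφ0 : 0 < φ := by linarith
  have hφ'0 : 0 < φ' := by linarith
  have hr0 : (0 : ℝ) < r := by exact_mod_cast hr
  set l := Real.log (6 / δ) with hl_def
  have hl : 0 ≤ l := Real.log_nonneg (by rw [le_div_iff₀ hδ]; linarith)
  have hexp : Real.exp (-l) = δ / 6 := by
    rw [Real.exp_neg, hl_def, Real.exp_log (by positivity), inv_div]
  have hA4 : ‖A‖ ^ 4 = (‖A‖ ^ 2) ^ 2 := by ring
  rw [hA4] at cond_ε cond_r cond_c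
  have hev1 := measure_norm_sketch_le hA hφ hr hS hl
  have hev2 := measure_gram_sketch_le hA hφ hr hS hl
  have hev3 := measure_second_sketch_le hφ' hc hSmeas hS hT hl
  rw [hexp] at hev1 hev2 hev3
  set a := ‖A‖ ^ 2 with ha_def
  simp only [le_min_iff] at cond_ε
  obtain ⟨⟨hε1, hε2⟩, hε3, hε4⟩ := cond_ε
  rw [le_div_iff₀ (by positivity)] at hε1 hε2 hε3 hε4
  obtain ⟨hr1, hr2⟩ := max_le_iff.1 cond_r
  have hη : φ * √(l / (2 * r)) ≤ 1 / 2 := by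
    refine (sq_le_sq₀ (by positivity) (by norm_num)).1 ?_
    rw [mul_pow, Real.sq_sqrt (by positivity), mul_div_assoc', div_le_iff₀ (by positivity)]
    linarith
  have hη1χ : φ * a * √(8 * l / r) ≤ 3 / 11 * χ := by
    refine mul_sqrt_le_of_sample_size hχ (by positivity) hl hr (le_trans ?_ hr2)
    rw [mul_pow, ← mul_assoc]
    gcongr
    exact le_add_of_nonneg_right (by positivity)
  have hη1γ : φ * a * √(8 * l / r) ≤ 3 / 11 * (γ / L) := by
    refine mul_sqrt_le_of_sample_size (by positivity) (by positivity) hl hr (le_trans ?_ hr2)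
    rw [mul_pow, ← mul_assoc, div_pow, div_div_eq_mul_div]
    gcongr
    exact le_add_of_nonneg_left (by positivity)
  have hη2χ : φ' * a * √(8 * l / c) ≤ 3 / 11 * χ := by
    refine mul_sqrt_le_of_sample_size hχ (by positivity) hl hc (le_trans ?_ cond_c)
    rw [mul_pow, ← mul_assoc]
    gcongr
    exact le_add_of_nonneg_right (by positivity)
  have hη2γ : φ' * a * √(8 * l / c) ≤ 3 / 11 * (γ / (2 * Lbar * a)) := by
    refine mul_sqrt_le_of_sample_size (by positivity) (by positivity) hl hc (le_trans ?_ cond_c)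
    rw [mul_pow, ← mul_assoc, div_pow, div_div_eq_mul_div]
    have : l * (2 * Lbar * a) ^ 2 / γ ^ 2 = 4 * l * Lbar ^ 2 * a ^ 2 / γ ^ 2 := by ring
    rw [this]
    gcongr
    exact le_add_of_nonneg_left (by positivity)
  set η₁ := φ * a * √(8 * l / r) with hη₁
  set η₂ := φ' * a * √(8 * l / c) with hη₂
  have hLη₁ : L * η₁ ≤ 3 / 11 * γ := by
    calc L * η₁ ≤ L * (3 / 11 * (γ / L)) := by gcongr
      _ = _ := by field_simp
  have hLη₂ : Lbar * a * η₂ ≤ 3 / 22 * γ := by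
    calc Lbar * a * η₂ ≤ Lbar * a * (3 / 11 * (γ / (2 * Lbar * a))) := by gcongr
      _ = _ := by field_simp; norm_num
  set good : Set Ω := {ω | ‖(sketchR (S ω) A)ᴴ *
            singularValueTransformation (fbar f)
              (Matrix.posSemidef_self_mul_conjTranspose (sketchC (S ω) A (T ω))) *
            sketchR (S ω) A -
          singularValueTransformation f (Matrix.posSemidef_conjTranspose_mul_self A)‖ ≤ γ}
  have hcover : goodᶜ ⊆
      ({ω | a + 2 * ε * (φ * a) + φ * a * √(l / (2 * r)) < ‖sketchR (S ω) A‖ ^ 2} ∪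
        {ω | 2 * ε * (φ * a) + η₁ < ‖(sketchR (S ω) A)ᴴ * sketchR (S ω) A - Aᴴ * A‖}) ∪
      {ω | 2 * ε * (φ' * ‖sketchR (S ω) A‖ ^ 2) +
          φ' * ‖sketchR (S ω) A‖ ^ 2 * √(8 * l / c) <
        ‖sketchC (S ω) A (T ω) * (sketchC (S ω) A (T ω))ᴴ -
          sketchR (S ω) A * (sketchR (S ω) A)ᴴ‖} := by
    intro ω hω
    by_contra hno
    simp only [Set.mem_union, Set.mem_ofPred_eq, not_or, not_lt] at hno
    obtain ⟨⟨h1, h2⟩, h3⟩ := hno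
    refine hω ?_
    set R := sketchR (S ω) A with hR
    set C := sketchC (S ω) A (T ω) with hC
    -- 7/4 = 1 + 2 · 1/8 + 1/2, from εφ ≤ 1/8 and `hη`.
    have hρ : ‖R‖ ^ 2 ≤ 7 / 4 * a := by
      have e1 : ε * φ * a ≤ 1 / 8 * a := by gcongr; linarith
      have e2 : φ * √(l / (2 * r)) * a ≤ 1 / 2 * a := by gcongr
      linarith
    have hd2 : ‖C * Cᴴ - R * Rᴴ‖ ≤ 7 / 4 * (2 * (ε * φ' * a) + η₂) := by
      refine h3.trans ?_
      calc 2 * ε * (φ' * ‖R‖ ^ 2) + φ' * ‖R‖ ^ 2 * √(8 * l / c)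
          ≤ 2 * ε * (φ' * (7 / 4 * a)) + φ' * (7 / 4 * a) * √(8 * l / c) := by gcongr
        _ = _ := by rw [hη₂]; ring
    have hCR : C * Cᴴ = R * (((T ω).map Complex.ofReal)ᴴ * (T ω).map Complex.ofReal) * Rᴴ := by
      simp only [hC, hR, sketchC, sketchR, Matrix.conjTranspose_mul,
        Matrix.conjTranspose_conjTranspose, Matrix.mul_assoc]
    -- The bias terms total at most 7/2 · ε(φ + φ')a ≤ 7χ/48, and the sampling terms at most (1 +
    -- 7/4) · 3χ/11 = 3χ/4.
    have hχsum : ‖Rᴴ * R - Aᴴ * A‖ + ‖C * Cᴴ - R * Rᴴ‖ ≤ χ := by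
      have e0 : 0 ≤ ε * φ * a := by positivity
      linarith
    refine (norm_sketched_singularValueTransformation_sub_le R hL.le hLbar.le
      (Matrix.posSemidef_conjTranspose_mul_self A) hf
      (Matrix.posSemidef_self_mul_conjTranspose C) hCR hχsum).trans ?_
    have t1 : L * ‖Rᴴ * R - Aᴴ * A‖ ≤ 1 / 12 * γ + 3 / 11 * γ := by
      calc L * ‖Rᴴ * R - Aᴴ * A‖ ≤ L * (2 * ε * (φ * a) + η₁) := by gcongr
        _ ≤ _ := by linarith
    have t2 : Lbar * ‖R‖ ^ 2 * ‖C * Cᴴ - R * Rᴴ‖ ≤ 49 / 16 * (1 / 24 * γ + 3 / 22 * γ) := by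
      calc Lbar * ‖R‖ ^ 2 * ‖C * Cᴴ - R * Rᴴ‖
          ≤ Lbar * (7 / 4 * a) * (7 / 4 * (2 * (ε * φ' * a) + η₂)) := by gcongr
        _ = 49 / 16 * (1 / 24 * (ε * (48 * Lbar * φ' * a ^ 2)) + Lbar * a * η₂) := by ring
        _ ≤ _ := by gcongr
    -- The coefficients of γ in `t1` and `t2` are about 0.356 and 0.545.
    linarith
  have hbadle : P goodᶜ ≤ ENNReal.ofReal δ := by
    refine (measure_mono hcover).trans ((measure_union_le _ _).trans ?_)
    refine (add_le_add ((measure_union_le _ _).trans (add_le_add hev1 hev2)) hev3).trans ?_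
    rw [← ENNReal.ofReal_add (by positivity) (by positivity),
      ← ENNReal.ofReal_add (by positivity) (by positivity)]
    -- The three events cost δ/6 + 2δ/6 + 2δ/6.
    exact ENNReal.ofReal_le_ofReal (by linarith)
  -- Subadditivity alone suffices here, so measurability of `good` is not needed.
  have huniv : 1 ≤ P good + ENNReal.ofReal δ := by
    calc (1 : ℝ≥0∞) = P (good ∪ goodᶜ) := by rw [Set.union_compl_self, measure_univ]
      _ ≤ P good + P goodᶜ := measure_union_le _ _
      _ ≤ _ := by gcongr
  rw [ENNReal.ofReal_sub _ hδ.le, ENNReal.ofReal_one]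
  exact tsub_le_iff_right.2 huniv
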